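/- Let $(M,g)$ be a smooth pseudo-Riemannian manifold with Levi-Civita connection $\nabla$, and let $S\to M$ be a real or complex spinor bundle or, more generally, any smooth vector bundle of finite rank over $\mathbb K\in\{\mathbb R,\mathbb C\}$ with a smooth $\mathbb K$-linear Clifford multiplication $\gamma:TM\otimes S\to S$, $\gamma(X)\gamma(Y)+\gamma(Y)\gamma(X)=-2g(X,Y)$, and a charge conjugation $C$, i.e. a smooth nondegenerate $\mathbb K$-bilinear form on $S$ with $C(\varphi,\psi)=\Delta_0C(\psi,\varphi)$ and $C(\varphi,\gamma(X)\psi)=\Delta_1C(\psi,\gamma(X)\varphi)$ for some signs $\Delta_0,\Delta_1\in\{\pm1\}$. Let $D$ be a smooth $\mathbb K$-linear connection on $S$ with curvature $R(X,Y)=D_XD_Y-D_YD_X-D_{[X,Y]}$. Let $D^C$ be the connection on $S$ determined by $X\big(C(\varphi,\psi)\big)=C(D_X\varphi,\psi)+C(\varphi,D^C_X\psi)$, put $(\hat D_X\gamma)(Y)\xi=D_X(\gamma(Y)\xi)-\gamma(\nabla_XY)\xi-\gamma(Y)D^C_X\xi$, and let the torsion of $D$ be $\mathcal T(X,Y)=(\hat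 D_X\gamma)(Y)-(\hat D_Y\gamma)(X)\in\mathrm{End}(S)$. The functions on the graded manifold $(M,\Gamma\Lambda S)$ are the smooth sections of $\Lambda S$ (exterior algebra over $\mathbb K$), and its vector fields are the graded derivations of $\Gamma\Lambda S$. For a vector field $X$ on $M$ let $\jmath_D(X)=D_X$, extended to $\Gamma\Lambda S$ as an even derivation which acts on functions on $M$ by $X$; an endomorphism of $S$ likewise acts on $\Gamma\Lambda S$ as an even derivation of degree zero that vanishes on functions on $M$. With a local frame $(e_\mu)$ of $TM$, its $g$-dual frame $(e^\mu)$, $g(e^\mu,e_\nu)=\delta^\mu_\nu$, and $\gamma^\mu=\gamma(e^\mu)$, $D^\nu=\jmath_D(e^\nu)$, $R_{\mu\nu}=R(e_\mu,e_\nu)$, $\mathcal T_{\mu\nu}=\mathcal T(e_\mu,e_\nu)$, set for $\varphi\in\Gamma S$ $$\imath(\varphi)=\gamma^\mu\varphi\otimes\jmath_D(e_\mu),\qquad\text{i.e.}\quad \imath(\varphi)f=\sum_\mu\gamma^\mu\varphi\wedge D_{e_\mu}f .$$ Let $\mathcal K\subset\{\eta\in\Gamma S: D^C\eta=0\}$ be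 a linear subspace such that $(\mathcal K,D)$ is admissible, i.e. $\big((\hat D_X\gamma)(Y)+(\hat D_Y\gamma)(X)\big)\eta=0$ for all $\eta\in\mathcal K$ and all $X,Y$. Then for all $\varphi,\psi\in\mathcal K$ the maps $\imath(\varphi),\imath(\psi)$ are odd vector fields on $(M,\Gamma\Lambda S)$, and their supercommutator $[\imath(\varphi),\imath(\psi)]=\imath(\varphi)\imath(\psi)+\imath(\psi)\imath(\varphi)$ is $$[\imath(\varphi),\imath(\psi)]=\mathfrak B(R;\varphi,\psi)+\tfrac12\,\mathfrak D(\mathcal T;\varphi,\psi),$$ where $$\mathfrak B(R;\varphi,\psi)=\gamma^\mu\varphi\wedge\gamma^\nu\psi\otimes R_{\mu\nu},\qquad \mathfrak D(\mathcal T;\varphi,\psi)=\big(\gamma^\mu\varphi\wedge\mathcal T_{\mu\nu}\psi+\gamma^\mu\psi\wedge\mathcal T_{\mu\nu}\varphi\big)\otimes D^\nu .$$ -/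

import Mathlib

open Bundle Module
open scoped Manifold ContDiff Topology


noncomputable section

namespace SpinorSuper

/-! ### Endomorphisms acting as derivations of the exterior algebra -/

section Algebra

variable {R : Type*} [CommRing R] {V : Type*} [AddCommGroup V] [Module R V]

/-- The algebra homomorphism from `Λ V` to the dual numbers over `Λ V` that extends
`v ↦ v + ε Φ(v)`. -/
def dualNumberLift (Φ : V →ₗ[R] V) :
    ExteriorAlgebra R V →ₐ[R] DualNumber (ExteriorAlgebra R V) :=
  ExteriorAlgebra.lift R
    ⟨{ toFun := fun v => TrivSqZeroExt.inl (ExteriorAlgebra.ι R v)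
          + TrivSqZeroExt.inr (ExteriorAlgebra.ι R (Φ v))
       map_add' := by
        intro v w
        ext <;> simp
       map_smul' := by
        intro c v
        ext <;> simp }, by
      intro v
      ext
      · simp
      · simp [ExteriorAlgebra.ι_add_mul_swap]⟩

/-- The derivation of degree zero of `Λ V` that extends the endomorphism `Φ` of `V`
(see `derivOfEnd_ι` and `derivOfEnd_mul`). -/
def derivOfEnd (Φ : V →ₗ[R] V) : ExteriorAlgebra R V →ₗ[R] ExteriorAlgebra R V :=
  (TrivSqZeroExt.sndHom (ExteriorAlgebra R V) (ExteriorAlgebra R V)).restrictScalars R ∘ₗ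
    (dualNumberLift Φ).toLinearMap

theorem dualNumberLift_ι (Φ : V →ₗ[R] V) (v : V) :
    dualNumberLift Φ (ExteriorAlgebra.ι R v) = TrivSqZeroExt.inl (ExteriorAlgebra.ι R v)
          + TrivSqZeroExt.inr (ExteriorAlgebra.ι R (Φ v)) := by
  simp [dualNumberLift]

theorem fst_dualNumberLift (Φ : V →ₗ[R] V) (a : ExteriorAlgebra R V) :
    (dualNumberLift Φ a).fst = a := by
  have h : (TrivSqZeroExt.fstHom R (ExteriorAlgebra R V) (ExteriorAlgebra R V)).comp
      (dualNumberLift Φ) = AlgHom.id R _ := by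
    apply ExteriorAlgebra.hom_ext
    ext v
    simp [dualNumberLift_ι]
  exact congrArg (fun f => f a) h

theorem derivOfEnd_ι (Φ : V →ₗ[R] V) (v : V) :
    derivOfEnd Φ (ExteriorAlgebra.ι R v) = ExteriorAlgebra.ι R (Φ v) := by
  simp [derivOfEnd, dualNumberLift_ι]

theorem derivOfEnd_mul (Φ : V →ₗ[R] V) (a b : ExteriorAlgebra R V) :
    derivOfEnd Φ (a * b) = derivOfEnd Φ a * b + a * derivOfEnd Φ b := by
  simp [derivOfEnd, fst_dualNumberLift, add_comm]

end Algebra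

/-! ### Pseudo-Riemannian metrics, Clifford multiplication, charge conjugation -/

variable (𝕜 : Type*) [RCLike 𝕜]
  {E : Type*} [NormedAddCommGroup E] [NormedSpace ℝ E]
  {H : Type*} [TopologicalSpace H] (I : ModelWithCorners ℝ E H)
  (M : Type*) [TopologicalSpace M] [ChartedSpace H M]

/-- A smooth pseudo-Riemannian metric of arbitrary signature. -/
structure PseudoRiemannianMetric [IsManifold I ∞ M] where
  /-- The bilinear form on each tangent space. -/
  val (x : M) : TangentSpace I x →L[ℝ] TangentSpace I x →L[ℝ] ℝ
  symm (x : M) (u v : TangentSpace I x) : val x u v = val x v u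
  nondegenerate (x : M) (u : TangentSpace I x) (hu : ∀ v, val x u v = 0) : u = 0
  contMDiff : ContMDiff I (I.prod 𝓘(ℝ, E →L[ℝ] E →L[ℝ] ℝ)) ∞
    (fun x ↦ TotalSpace.mk' (E →L[ℝ] E →L[ℝ] ℝ) x (val x))

variable {I M}

section Metric

variable [IsManifold I ∞ M] (g : PseudoRiemannianMetric I M)

/-- The metric at `x` as a bilinear form. -/
def PseudoRiemannianMetric.form (x : M) : LinearMap.BilinForm ℝ (TangentSpace I x) :=
  LinearMap.mk₂ ℝ (fun u v => g.val x u v) (by simp) (by simp) (by simp) (by simp)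

theorem PseudoRiemannianMetric.form_nondegenerate (x : M) : (g.form x).Nondegenerate := by
  refine ⟨fun u hu => g.nondegenerate x u hu, fun u hu => g.nondegenerate x u fun v => ?_⟩
  rw [g.symm]
  exact hu v

/-- The `g`-dual basis `e^μ` of a basis `e_μ` of a tangent space: `g(e^μ, e_ν) = δ^μ_ν`. -/
def PseudoRiemannianMetric.raise {ι : Type*} [Fintype ι] [DecidableEq ι] {x : M}
    (e : Basis ι ℝ (TangentSpace I x)) (μ : ι) : TangentSpace I x :=
  haveI : FiniteDimensional ℝ (TangentSpace I x) := e.finiteDimensional_of_finite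
  (g.form x).dualBasis (g.form_nondegenerate x) e μ

theorem PseudoRiemannianMetric.val_raise {ι : Type*} [Fintype ι] [DecidableEq ι] {x : M}
    (e : Basis ι ℝ (TangentSpace I x)) (μ ν : ι) :
    g.val x (g.raise e μ) (e ν) = if ν = μ then 1 else 0 :=
  haveI : FiniteDimensional ℝ (TangentSpace I x) := e.finiteDimensional_of_finite
  (g.form x).apply_dualBasis_left (g.form_nondegenerate x) e μ ν

/-- `nabla` is the Levi-Civita connection of `g`: torsion free and metric. The derivative
`∇_v Y` at `x` is written `nabla Y x v`. -/
structure IsLeviCivita (nabla : CovariantDerivative I E (TangentSpace I : M → Type _)) :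
    Prop where
  torsion_free : ∀ (x : M) (X Y : Π y : M, TangentSpace I y),
    MDifferentiableAt I (I.prod 𝓘(ℝ, E)) (fun y ↦ TotalSpace.mk' E y (X y)) x →
    MDifferentiableAt I (I.prod 𝓘(ℝ, E)) (fun y ↦ TotalSpace.mk' E y (Y y)) x →
    nabla Y x (X x) - nabla X x (Y x) = VectorField.mlieBracket I X Y x
  metric : ∀ (x : M) (v : TangentSpace I x) (Y Z : Π y : M, TangentSpace I y),
    MDifferentiableAt I (I.prod 𝓘(ℝ, E)) (fun y ↦ TotalSpace.mk' E y (Y y)) x →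
    MDifferentiableAt I (I.prod 𝓘(ℝ, E)) (fun y ↦ TotalSpace.mk' E y (Z y)) x →
    mvfderiv I (fun y => g.val y (Y y) (Z y)) x v
      = g.val x (nabla Y x v) (Z x) + g.val x (Y x) (nabla Z x v)

end Metric

variable (F : Type*) [NormedAddCommGroup F] [NormedSpace ℝ F] [NormedSpace 𝕜 F]
  (S : M → Type*) [TopologicalSpace (TotalSpace F S)]
  [∀ x, AddCommGroup (S x)] [∀ x, Module ℝ (S x)] [∀ x, Module 𝕜 (S x)]
  [∀ x, TopologicalSpace (S x)] [∀ x, IsTopologicalAddGroup (S x)]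
  [∀ x, ContinuousSMul ℝ (S x)]
  [FiberBundle F S] [VectorBundle ℝ F S] [VectorBundle 𝕜 F S]

section Spinor

variable [IsManifold I ∞ M] (g : PseudoRiemannianMetric I M)

/-- A smooth, `𝕜`-linear Clifford multiplication of `TM` on the bundle `S`,
with `XY + YX = -2 g(X, Y)`. -/
structure CliffordMultiplication where
  /-- `γ(u) : S_x → S_x` for `u ∈ T_x M`. -/
  val (x : M) : TangentSpace I x →L[ℝ] S x →L[ℝ] S x
  map_smul (x : M) (u : TangentSpace I x) (c : 𝕜) (s : S x) : val x u (c • s) = c • val x u s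
  clifford (x : M) (u v : TangentSpace I x) (s : S x) :
    val x u (val x v s) + val x v (val x u s) = (-2 * g.val x u v) • s
  contMDiff : ContMDiff I (I.prod 𝓘(ℝ, E →L[ℝ] F →L[ℝ] F)) ∞
    (fun x ↦ TotalSpace.mk' (E →L[ℝ] F →L[ℝ] F) x (val x))

variable {F S g} in
/-- A charge conjugation: a smooth, nondegenerate, `𝕜`-bilinear form `C` on `S` such that
`C(φ, ψ)` and `C(φ, γ(u) ψ)` have symmetries `Δ₀, Δ₁ ∈ {1, -1}` in `φ, ψ`. The two symmetries
together give `C(γ(u)φ, ψ) = Δ₀ Δ₁ C(φ, γ(u)ψ)`, hence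
`C(γ(u)γ(v)φ, ψ) = C(φ, γ(v)γ(u)ψ)`, which is the invariance under the spin group. -/
structure ChargeConjugation (γ : CliffordMultiplication 𝕜 F S g) where
  /-- The form on each fibre. -/
  val (x : M) : S x →L[ℝ] S x →L[ℝ] 𝕜
  map_smul_left (x : M) (c : 𝕜) (s t : S x) : val x (c • s) t = c * val x s t
  map_smul_right (x : M) (c : 𝕜) (s t : S x) : val x s (c • t) = c * val x s t
  nondegenerate (x : M) (s : S x) (hs : ∀ t, val x s t = 0) : s = 0
  exists_symm₀ : ∃ Δ₀ : ℤˣ, ∀ (x : M) (s t : S x), val x s t = ((Δ₀ : ℤ) : 𝕜) * val x t s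
  exists_symm₁ : ∃ Δ₁ : ℤˣ, ∀ (x : M) (u : TangentSpace I x) (s t : S x),
    val x s (γ.val x u t) = ((Δ₁ : ℤ) : 𝕜) * val x t (γ.val x u s)
  contMDiff : ContMDiff I (I.prod 𝓘(ℝ, F →L[ℝ] F →L[ℝ] 𝕜)) ∞
    (fun x ↦ TotalSpace.mk' (F →L[ℝ] F →L[ℝ] 𝕜) (E := fun x => S x →L[ℝ] S x →L[ℝ] 𝕜) x (val x))

variable (I) in
/-- A smooth `𝕜`-linear connection on `S`. The derivative `D_v σ` at `x` is written `D σ x v`;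
smoothness says that `D` maps sections that are smooth on an open set to smooth sections
of `T*M ⊗ S` on that set. -/
structure SpinorConnection extends CovariantDerivative I F S where
  map_smul : ∀ (x : M) (c : 𝕜) (σ : Π y : M, S y),
    MDifferentiableAt I (I.prod 𝓘(ℝ, F)) (fun y ↦ TotalSpace.mk' F y (σ y)) x →
    ∀ v : TangentSpace I x, toFun (c • σ) x v = c • toFun σ x v
  contMDiffOn : ∀ U : Set M, IsOpen U → ContMDiffCovariantDerivativeOn F ∞ toFun U

variable {𝕜 F S g}

/-- `DC` is the connection `D^C` associated with `D` and the charge conjugation `C`: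
`D ⊗ 1 + 1 ⊗ D^C` makes `C` parallel. As `C` is nondegenerate, this determines `D^C`. -/
def IsChargeAdjoint {γ : CliffordMultiplication 𝕜 F S g} (C : ChargeConjugation 𝕜 γ)
    (D DC : SpinorConnection 𝕜 I F S) : Prop :=
  ∀ (x : M) (v : TangentSpace I x) (σ τ : Π y : M, S y),
    MDifferentiableAt I (I.prod 𝓘(ℝ, F)) (fun y ↦ TotalSpace.mk' F y (σ y)) x →
    MDifferentiableAt I (I.prod 𝓘(ℝ, F)) (fun y ↦ TotalSpace.mk' F y (τ y)) x →
    mvfderiv I (fun y => C.val y (σ y) (τ y)) x v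
      = C.val x (D.toFun σ x v) (τ x) + C.val x (σ x) (DC.toFun τ x v)

end Spinor

/-! ### Endomorphism valued tensors: curvature, `D̂γ` and the torsion -/

section Tensors

/-- The local section of a vector bundle `W` through `s ∈ W_x` with constant coefficients in
the preferred trivialization at `x` (and zero where this trivialization is not defined). -/
def localExt (R : Type*) [NontriviallyNormedField R] {B : Type*} [TopologicalSpace B]
    (Z : Type*) [NormedAddCommGroup Z] [NormedSpace R Z] {W : B → Type*}
    [TopologicalSpace (TotalSpace Z W)] [∀ x, AddCommGroup (W x)] [∀ x, Module R (W x)]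
    [∀ x, TopologicalSpace (W x)] [FiberBundle Z W] [VectorBundle R Z W]
    {x : B} (s : W x) (y : B) : W y :=
  (trivializationAt Z W x).symmₗ R y ((trivializationAt Z W x).linearMapAt R x s)

section LocalExt

variable (R : Type*) [NontriviallyNormedField R] {B : Type*} [TopologicalSpace B]
    (Z : Type*) [NormedAddCommGroup Z] [NormedSpace R Z] {W : B → Type*}
    [TopologicalSpace (TotalSpace Z W)] [∀ x, AddCommGroup (W x)] [∀ x, Module R (W x)]
    [∀ x, TopologicalSpace (W x)] [FiberBundle Z W] [VectorBundle R Z W]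

theorem localExt_add {x : B} (s t : W x) :
    localExt R Z (s + t) = localExt R Z s + localExt R Z t := by
  funext y
  simp [localExt]

theorem localExt_smul {x : B} (c : R) (s : W x) :
    localExt R Z (c • s) = c • localExt R Z s := by
  funext y
  simp [localExt]

theorem localExt_eq_extend {x : B} (s : W x) {y : B} (hy : y ∈ (trivializationAt Z W x).baseSet) :
    localExt R Z s y = FiberBundle.extend Z s y := by
  rw [localExt, Trivialization.coe_symmₗ _ hy,
    Trivialization.coe_linearMapAt_of_mem _ (FiberBundle.mem_baseSet_trivializationAt' x)]
  rfl

theorem localExt_self {x : B} (s : W x) : localExt R Z s x = s := by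
  rw [localExt_eq_extend R Z s (FiberBundle.mem_baseSet_trivializationAt' x)]
  simp

end LocalExt

theorem exists_contMDiffOn_localExt (R : Type*) [NontriviallyNormedField R]
    (Z : Type*) [NormedAddCommGroup Z] [NormedSpace ℝ Z] [NormedSpace R Z] {W : M → Type*}
    [TopologicalSpace (TotalSpace Z W)] [∀ x, AddCommGroup (W x)] [∀ x, Module ℝ (W x)]
    [∀ x, Module R (W x)] [∀ x, TopologicalSpace (W x)] [FiberBundle Z W] [VectorBundle ℝ Z W]
    [VectorBundle R Z W] [ContMDiffVectorBundle ∞ Z W I] {x : M} (s : W x) :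
    ∃ U : Set M, IsOpen U ∧ x ∈ U ∧ ContMDiffOn I (I.prod 𝓘(ℝ, Z)) ∞
      (fun y ↦ TotalSpace.mk' Z y (localExt R Z s y)) U := by
  obtain ⟨V, hV, h⟩ := FiberBundle.exists_contMDiffOn_extend (k := ∞) I Z s
  obtain ⟨U, hUV, hU, hxU⟩ := mem_nhds_iff.1 hV
  refine ⟨U ∩ (trivializationAt Z W x).baseSet, hU.inter (trivializationAt Z W x).open_baseSet,
    ⟨hxU, FiberBundle.mem_baseSet_trivializationAt' x⟩, ?_⟩
  refine (h.mono (Set.inter_subset_left.trans hUV)).congr fun y hy => ?_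
  rw [localExt_eq_extend R Z s hy.2]

theorem mdifferentiableAt_localExt (R : Type*) [NontriviallyNormedField R]
    (Z : Type*) [NormedAddCommGroup Z] [NormedSpace ℝ Z] [NormedSpace R Z] {W : M → Type*}
    [TopologicalSpace (TotalSpace Z W)] [∀ x, AddCommGroup (W x)] [∀ x, Module ℝ (W x)]
    [∀ x, Module R (W x)] [∀ x, TopologicalSpace (W x)] [FiberBundle Z W] [VectorBundle ℝ Z W]
    [VectorBundle R Z W] [ContMDiffVectorBundle ∞ Z W I] {x : M} (s : W x) :
    MDifferentiableAt I (I.prod 𝓘(ℝ, Z)) (fun y ↦ TotalSpace.mk' Z y (localExt R Z s y)) x := by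
  obtain ⟨U, hU, hx, h⟩ := exists_contMDiffOn_localExt (I := I) R Z s
  exact (h.contMDiffAt (hU.mem_nhds hx)).mdifferentiableAt (by simp)

variable [IsManifold I ∞ M] {g : PseudoRiemannianMetric I M} {F S 𝕜}
  [IsScalarTower ℝ 𝕜 F] [ContMDiffVectorBundle ∞ F S I]

theorem SpinorConnection.contMDiffOn_apply (D : SpinorConnection 𝕜 I F S) {U : Set M}
    (hU : IsOpen U) {σ : Π y : M, S y} {Y : Π y : M, TangentSpace I y}
    (hσ : ContMDiffOn I (I.prod 𝓘(ℝ, F)) ∞ (fun y ↦ TotalSpace.mk' F y (σ y)) U)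
    (hY : ContMDiffOn I (I.prod 𝓘(ℝ, E)) ∞ (fun y ↦ TotalSpace.mk' E y (Y y)) U) :
    ContMDiffOn I (I.prod 𝓘(ℝ, F)) ∞
      (fun y ↦ TotalSpace.mk' F y (D.toFun σ y (Y y))) U :=
  ((D.contMDiffOn U hU).contMDiff (σ := σ) hσ).clm_bundle_apply hY

theorem exists_nhds_smooth {x : M} (s t : S x) (v : TangentSpace I x) :
    ∃ U : Set M, IsOpen U ∧ x ∈ U ∧
      ContMDiffOn I (I.prod 𝓘(ℝ, F)) ∞ (fun y ↦ TotalSpace.mk' F y (localExt 𝕜 F s y)) U ∧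
      ContMDiffOn I (I.prod 𝓘(ℝ, F)) ∞ (fun y ↦ TotalSpace.mk' F y (localExt 𝕜 F t y)) U ∧
      ContMDiffOn I (I.prod 𝓘(ℝ, E)) ∞ (fun y ↦ TotalSpace.mk' E y (localExt ℝ E v y)) U := by
  obtain ⟨U₁, hU₁, hx₁, h₁⟩ := exists_contMDiffOn_localExt (I := I) 𝕜 F s
  obtain ⟨U₂, hU₂, hx₂, h₂⟩ := exists_contMDiffOn_localExt (I := I) 𝕜 F t
  obtain ⟨U₃, hU₃, hx₃, h₃⟩ := exists_contMDiffOn_localExt (I := I) ℝ E v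
  exact ⟨U₁ ∩ U₂ ∩ U₃, (hU₁.inter hU₂).inter hU₃, ⟨⟨hx₁, hx₂⟩, hx₃⟩,
    h₁.mono fun y hy => hy.1.1, h₂.mono fun y hy => hy.1.2, h₃.mono fun y hy => hy.2⟩

theorem secondDeriv_add (D : SpinorConnection 𝕜 I F S) {x : M} (u v : TangentSpace I x)
    (s t : S x) :
    D.toFun (fun y => D.toFun (localExt 𝕜 F (s + t)) y (localExt ℝ E v y)) x u
      = D.toFun (fun y => D.toFun (localExt 𝕜 F s) y (localExt ℝ E v y)) x u
        + D.toFun (fun y => D.toFun (localExt 𝕜 F t) y (localExt ℝ E v y)) x u := by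
  obtain ⟨U, hU, hxU, k₁, k₂, k₃⟩ := exists_nhds_smooth (𝕜 := 𝕜) (F := F) s t v
  have hx : U ∈ 𝓝 x := hU.mem_nhds hxU
  have m₁ := ((D.contMDiffOn_apply hU k₁ k₃).contMDiffAt hx).mdifferentiableAt (by simp)
  have m₂ := ((D.contMDiffOn_apply hU k₂ k₃).contMDiffAt hx).mdifferentiableAt (by simp)
  have hD := D.isCovariantDerivativeOnUniv
  have heq : ∀ y ∈ U, D.toFun (localExt 𝕜 F (s + t)) y (localExt ℝ E v y)
      = D.toFun (localExt 𝕜 F s) y (localExt ℝ E v y)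
        + D.toFun (localExt 𝕜 F t) y (localExt ℝ E v y) := by
    intro y hy
    rw [localExt_add, hD.add ((k₁.contMDiffAt (hU.mem_nhds hy)).mdifferentiableAt (by simp))
      ((k₂.contMDiffAt (hU.mem_nhds hy)).mdifferentiableAt (by simp))]
    rfl
  have hm := mdifferentiableAt_add_section m₁ m₂
  have key := hD.congr_of_eventuallyEq
    (σ := fun y => D.toFun (localExt 𝕜 F (s + t)) y (localExt ℝ E v y))
    (σ' := (fun y => D.toFun (localExt 𝕜 F s) y (localExt ℝ E v y))
      + (fun y => D.toFun (localExt 𝕜 F t) y (localExt ℝ E v y))) (x := x)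
    (hm.congr_of_eventuallyEq ?_) hm Filter.univ_mem ?_
  · rw [key, hD.add m₁ m₂]
    rfl
  · filter_upwards [hx] with y hy
    rw [heq y hy]
    rfl
  · filter_upwards [hx] with y hy
    exact heq y hy

theorem mdifferentiableAt_smul_section (c : 𝕜) {x : M} {σ : Π y : M, S y}
    (h : MDifferentiableAt I (I.prod 𝓘(ℝ, F)) (fun y ↦ TotalSpace.mk' F y (σ y)) x) :
    MDifferentiableAt I (I.prod 𝓘(ℝ, F)) (fun y ↦ TotalSpace.mk' F y ((c • σ) y)) x := by
  rw [mdifferentiableAt_section] at h ⊢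
  have h' : MDifferentiableAt I 𝓘(ℝ, F)
      (fun y => c • (trivializationAt F S x (TotalSpace.mk' F y (σ y))).2) x := by
    have hc : Differentiable ℝ (fun w : F => c • w) := differentiable_id.const_smul c
    exact (hc _).mdifferentiableAt.comp x h
  refine h'.congr_of_eventuallyEq ?_
  filter_upwards [(trivializationAt F S x).open_baseSet.mem_nhds
    (FiberBundle.mem_baseSet_trivializationAt' x)] with y hy
  exact (Trivialization.linear 𝕜 (trivializationAt F S x) hy).map_smul c (σ y)

theorem secondDeriv_smul (D : SpinorConnection 𝕜 I F S) {x : M} (u v : TangentSpace I x)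
    (c : 𝕜) (s : S x) :
    D.toFun (fun y => D.toFun (localExt 𝕜 F (c • s)) y (localExt ℝ E v y)) x u
      = c • D.toFun (fun y => D.toFun (localExt 𝕜 F s) y (localExt ℝ E v y)) x u := by
  obtain ⟨U, hU, hxU, k₁, k₂, k₃⟩ := exists_nhds_smooth (𝕜 := 𝕜) (F := F) s s v
  have hx : U ∈ 𝓝 x := hU.mem_nhds hxU
  have m₁ := ((D.contMDiffOn_apply hU k₁ k₃).contMDiffAt hx).mdifferentiableAt (by simp)
  have hD := D.isCovariantDerivativeOnUniv
  have heq : ∀ y ∈ U, D.toFun (localExt 𝕜 F (c • s)) y (localExt ℝ E v y)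
      = c • D.toFun (localExt 𝕜 F s) y (localExt ℝ E v y) := by
    intro y hy
    rw [localExt_smul,
      D.map_smul _ _ _ ((k₁.contMDiffAt (hU.mem_nhds hy)).mdifferentiableAt (by simp))]
  have hm := mdifferentiableAt_smul_section c m₁
  have key := hD.congr_of_eventuallyEq
    (σ := fun y => D.toFun (localExt 𝕜 F (c • s)) y (localExt ℝ E v y))
    (σ' := c • (fun y => D.toFun (localExt 𝕜 F s) y (localExt ℝ E v y))) (x := x)
    (hm.congr_of_eventuallyEq ?_) hm Filter.univ_mem ?_
  · rw [key, D.map_smul _ _ _ m₁]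
  · filter_upwards [hx] with y hy
    rw [heq y hy]
    rfl
  · filter_upwards [hx] with y hy
    exact heq y hy

/-- The curvature `R(u, v) ∈ End(S_x)`,
`R(X, Y)σ = D_X D_Y σ - D_Y D_X σ - D_[X,Y] σ`, where `X, Y, σ` extend `u, v, s`. -/
def curvature (D : SpinorConnection 𝕜 I F S) (x : M) (u v : TangentSpace I x) :
    S x →ₗ[𝕜] S x where
  toFun s :=
    D.toFun (fun y => D.toFun (localExt 𝕜 F s) y (localExt ℝ E v y)) x u
      - D.toFun (fun y => D.toFun (localExt 𝕜 F s) y (localExt ℝ E u y)) x v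
      - D.toFun (localExt 𝕜 F s) x
          (VectorField.mlieBracket I (localExt ℝ E u) (localExt ℝ E v) x)
  map_add' s t := by
    rw [secondDeriv_add, secondDeriv_add, localExt_add,
      D.isCovariantDerivativeOnUniv.add (mdifferentiableAt_localExt 𝕜 F s)
        (mdifferentiableAt_localExt 𝕜 F t), add_apply]
    abel
  map_smul' c s := by
    rw [secondDeriv_smul, secondDeriv_smul, localExt_smul,
      D.map_smul _ _ _ (mdifferentiableAt_localExt 𝕜 F s), RingHom.id_apply, smul_sub, smul_sub]

/-- The connection form of `D` at `x` in the direction `v`: the endomorphism `s ↦ D_v σ`, where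
`σ` is the constant coefficient extension of `s`. -/
def connectionForm (D : SpinorConnection 𝕜 I F S) (x : M) (v : TangentSpace I x) :
    S x →ₗ[𝕜] S x where
  toFun s := D.toFun (localExt 𝕜 F s) x v
  map_add' s t := by
    rw [localExt_add, D.isCovariantDerivativeOnUniv.add (mdifferentiableAt_localExt 𝕜 F s)
        (mdifferentiableAt_localExt 𝕜 F t), add_apply]
  map_smul' c s := by
    rw [localExt_smul, D.map_smul _ _ _ (mdifferentiableAt_localExt 𝕜 F s), RingHom.id_apply]

theorem mdifferentiableAt_clifford (γ : CliffordMultiplication 𝕜 F S g) {x : M}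
    (v : TangentSpace I x) (s : S x) :
    MDifferentiableAt I (I.prod 𝓘(ℝ, F)) (fun y ↦ TotalSpace.mk' F y
      (γ.val y (localExt ℝ E v y) (localExt 𝕜 F s y))) x :=
  MDifferentiableAt.clm_bundle_apply₂ (F₁ := E) (F₂ := F)
    ((γ.contMDiff x).mdifferentiableAt (by simp)) (mdifferentiableAt_localExt ℝ E v)
    (mdifferentiableAt_localExt 𝕜 F s)

/-- The endomorphism `(D̂_u γ)(v)` of `S_x`,
`(D̂_Z γ)(X) ξ = D_Z (γ(X) ξ) - γ(∇_Z X) ξ - γ(X) D^C_Z ξ`, where `X, ξ` extend `v, s`. -/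
def hatDgamma (γ : CliffordMultiplication 𝕜 F S g)
    (nabla : CovariantDerivative I E (TangentSpace I : M → Type _))
    (D DC : SpinorConnection 𝕜 I F S) (x : M) (u v : TangentSpace I x) : S x →ₗ[𝕜] S x where
  toFun s :=
    D.toFun (fun y => γ.val y (localExt ℝ E v y) (localExt 𝕜 F s y)) x u
      - γ.val x (nabla (localExt ℝ E v) x u) s
      - γ.val x v (DC.toFun (localExt 𝕜 F s) x u)
  map_add' s t := by
    have h : (fun y => γ.val y (localExt ℝ E v y) (localExt 𝕜 F (s + t) y))
      = (fun y => γ.val y (localExt ℝ E v y) (localExt 𝕜 F s y))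
        + (fun y => γ.val y (localExt ℝ E v y) (localExt 𝕜 F t y)) := by
      funext y
      simp [localExt_add]
    rw [h, D.isCovariantDerivativeOnUniv.add (mdifferentiableAt_clifford γ v s)
      (mdifferentiableAt_clifford γ v t), localExt_add,
      DC.isCovariantDerivativeOnUniv.add (mdifferentiableAt_localExt 𝕜 F s)
        (mdifferentiableAt_localExt 𝕜 F t)]
    simp only [add_apply, map_add]
    abel
  map_smul' c s := by
    have h : (fun y => γ.val y (localExt ℝ E v y) (localExt 𝕜 F (c • s) y))
      = c • (fun y => γ.val y (localExt ℝ E v y) (localExt 𝕜 F s y)) := by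
      funext y
      simp [localExt_smul, γ.map_smul]
    rw [h, D.map_smul _ _ _ (mdifferentiableAt_clifford γ v s), localExt_smul,
      DC.map_smul _ _ _ (mdifferentiableAt_localExt 𝕜 F s), γ.map_smul, γ.map_smul,
      RingHom.id_apply, smul_sub, smul_sub]

/-- The torsion `𝒯(u, v) ∈ End(S_x)` of `D`: two times the skew symmetrization of `D̂γ`. -/
def torsion (γ : CliffordMultiplication 𝕜 F S g)
    (nabla : CovariantDerivative I E (TangentSpace I : M → Type _))
    (D DC : SpinorConnection 𝕜 I F S) (x : M) (u v : TangentSpace I x) : S x →ₗ[𝕜] S x :=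
  hatDgamma γ nabla D DC x u v - hatDgamma γ nabla D DC x v u

/-- `(𝒦, D)` is admissible: the symmetric part of `D̂γ` acts trivially on `𝒦`. -/
def IsAdmissible (γ : CliffordMultiplication 𝕜 F S g)
    (nabla : CovariantDerivative I E (TangentSpace I : M → Type _))
    (D DC : SpinorConnection 𝕜 I F S) (K : Set (ContMDiffSection I F ∞ S)) : Prop :=
  ∀ φ ∈ K, ∀ (x : M) (u v : TangentSpace I x),
    (hatDgamma γ nabla D DC x u v + hatDgamma γ nabla D DC x v u) (φ x) = 0

end Tensors

/-! ### The graded manifold `(M, ΓΛS)` -/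

section GradedManifold

variable {F S 𝕜} [FiniteDimensional 𝕜 F]

/-- The coefficient functions `f_A` in `f = ∑_A f_A θ_A` of a section `f` of `ΛS`, with respect to
the local frame `θ_A = θ_{k_1} ∧ ⋯ ∧ θ_{k_p}`, `A = {k_1 < ⋯ < k_p}`, where `θ_k` is the local frame
of `S` given by the preferred trivialization at `x₀` and a basis of the model fibre `F`. -/
def coeff (x₀ : M) (f : Π x, ExteriorAlgebra 𝕜 (S x)) (A : Finset (Fin (finrank 𝕜 F))) (x : M) :
    𝕜 :=
  (finBasis 𝕜 F).ExteriorAlgebra.repr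
    (ExteriorAlgebra.map ((trivializationAt F S x₀).linearMapAt 𝕜 x) (f x)) A

/-- The element `θ_A(x₀)` of the frame of `ΛS` at `x₀` that belongs to `coeff`. -/
def frameAt (x₀ : M) (A : Finset (Fin (finrank 𝕜 F))) : ExteriorAlgebra 𝕜 (S x₀) :=
  ExteriorAlgebra.map ((trivializationAt F S x₀).symmₗ 𝕜 x₀) ((finBasis 𝕜 F).ExteriorAlgebra A)

variable (I F) in
/-- The functions on the graded manifold: smooth sections of `ΛS`. -/
def IsSuperfunction (f : Π x, ExteriorAlgebra 𝕜 (S x)) : Prop :=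
  ∀ (x₀ : M) (A : Finset (Fin (finrank 𝕜 F))),
    ContMDiffAt I 𝓘(ℝ, 𝕜) ∞ (coeff (F := F) x₀ f A) x₀

/-- Superfunctions of parity `p`. -/
def IsHomogeneous (p : ZMod 2) (f : Π x, ExteriorAlgebra 𝕜 (S x)) : Prop :=
  ∀ x, f x ∈ CliffordAlgebra.evenOdd (0 : QuadraticForm 𝕜 (S x)) p

variable (I F) in
/-- `Z` is a vector field of parity `p` on the graded manifold: a graded derivation
of parity `p` of the algebra of superfunctions. -/
structure IsSuperVectorField (p : ZMod 2)
    (Z : (Π x, ExteriorAlgebra 𝕜 (S x)) → (Π x, ExteriorAlgebra 𝕜 (S x))) : Prop where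
  smooth : ∀ f, IsSuperfunction I F f → IsSuperfunction I F (Z f)
  map_add : ∀ f h, IsSuperfunction I F f → IsSuperfunction I F h → Z (f + h) = Z f + Z h
  map_smul : ∀ (c : 𝕜) f, IsSuperfunction I F f → Z (c • f) = c • Z f
  parity : ∀ (q : ZMod 2) f, IsSuperfunction I F f → IsHomogeneous q f →
    IsHomogeneous (p + q) (Z f)
  leibniz : ∀ (q : ZMod 2) f h, IsSuperfunction I F f → IsHomogeneous q f →
    IsSuperfunction I F h → Z (f * h) = Z f * h + (-1 : 𝕜) ^ (p.val * q.val) • (f * Z h)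

/-- The supercommutator `[Z, W] = Z W - (-1)^{pq} W Z` of vector fields of parities `p, q`. -/
def superBracket (p q : ZMod 2)
    (Z W : (Π x, ExteriorAlgebra 𝕜 (S x)) → (Π x, ExteriorAlgebra 𝕜 (S x)))
    (f : Π x, ExteriorAlgebra 𝕜 (S x)) : Π x, ExteriorAlgebra 𝕜 (S x) :=
  Z (W f) - (-1 : 𝕜) ^ (p.val * q.val) • W (Z f)

variable [IsScalarTower ℝ 𝕜 F] [ContMDiffVectorBundle ∞ F S I] [IsManifold I ∞ M]

/-- The action of `ȷ_D(v)`, `v ∈ T_x M`, on superfunctions, i.e. the covariant derivative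
`D_v f ∈ ΛS_x` for the extension of `D` to `ΛS` as a derivation of degree zero:
`D_v (∑_A f_A θ_A) = ∑_A (v f_A) θ_A + ∑_A f_A D_v θ_A`. -/
def superD (D : SpinorConnection 𝕜 I F S) (f : Π x, ExteriorAlgebra 𝕜 (S x)) (x : M)
    (v : TangentSpace I x) : ExteriorAlgebra 𝕜 (S x) :=
  ∑ A : Finset (Fin (finrank 𝕜 F)),
      (mvfderiv I (coeff (F := F) x f A) x v : 𝕜) • frameAt (F := F) x A
    + derivOfEnd (connectionForm D x v) (f x)

variable {g : PseudoRiemannianMetric I M} {ι : Type*} [Fintype ι] [DecidableEq ι]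

/-- The vector field `ı(φ) = γ^μ φ ⊗ ȷ_D(e_μ)` on the graded manifold. Here `e` is a choice of a
basis of each tangent space; as a contraction with the metric, the sum does not depend on it. -/
def iota (γ : CliffordMultiplication 𝕜 F S g) (D : SpinorConnection 𝕜 I F S)
    (e : ∀ x : M, Basis ι ℝ (TangentSpace I x)) (φ : Π x, S x)
    (f : Π x, ExteriorAlgebra 𝕜 (S x)) (x : M) : ExteriorAlgebra 𝕜 (S x) :=
  ∑ μ, ExteriorAlgebra.ι 𝕜 (γ.val x (g.raise (e x) μ) (φ x)) * superD D f x (e x μ)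

/-- The curvature term `𝔅(R; φ, ψ) = γ^μ φ ∧ γ^ν ψ ⊗ R_{μν}`, for a `2`-form `R` with values in
the endomorphisms of `S`; `R_{μν}` acts on superfunctions as a derivation of degree zero. -/
def curvatureTerm (γ : CliffordMultiplication 𝕜 F S g)
    (R : ∀ x : M, TangentSpace I x → TangentSpace I x → S x →ₗ[𝕜] S x)
    (e : ∀ x : M, Basis ι ℝ (TangentSpace I x)) (φ ψ : Π x, S x)
    (f : Π x, ExteriorAlgebra 𝕜 (S x)) (x : M) : ExteriorAlgebra 𝕜 (S x) :=
  ∑ μ, ∑ ν, ExteriorAlgebra.ι 𝕜 (γ.val x (g.raise (e x) μ) (φ x))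
    * ExteriorAlgebra.ι 𝕜 (γ.val x (g.raise (e x) ν) (ψ x))
    * derivOfEnd (R x (e x μ) (e x ν)) (f x)

/-- The torsion term
`𝔇(𝒯; φ, ψ) = (γ^μ φ ∧ 𝒯_{μν} ψ + γ^μ ψ ∧ 𝒯_{μν} φ) ⊗ D^ν`, for a `2`-form `T` with values in the
endomorphisms of `S`. -/
def torsionTerm (γ : CliffordMultiplication 𝕜 F S g) (D : SpinorConnection 𝕜 I F S)
    (T : ∀ x : M, TangentSpace I x → TangentSpace I x → S x →ₗ[𝕜] S x)
    (e : ∀ x : M, Basis ι ℝ (TangentSpace I x)) (φ ψ : Π x, S x)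
    (f : Π x, ExteriorAlgebra 𝕜 (S x)) (x : M) : ExteriorAlgebra 𝕜 (S x) :=
  ∑ μ, ∑ ν,
    (ExteriorAlgebra.ι 𝕜 (γ.val x (g.raise (e x) μ) (φ x))
        * ExteriorAlgebra.ι 𝕜 (T x (e x μ) (e x ν) (ψ x))
      + ExteriorAlgebra.ι 𝕜 (γ.val x (g.raise (e x) μ) (ψ x))
        * ExteriorAlgebra.ι 𝕜 (T x (e x μ) (e x ν) (φ x)))
    * superD D f x (g.raise (e x) ν)

end GradedManifold

end SpinorSuper

end

open SpinorSuper

/-! Each `ı(φ)` is a contraction over dual frames, hence does not depend on the frame, and near a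
point `x` it may be computed in a frame with constant coefficients in a trivialization. Applying
`D_u` to `ı(ψ)f = ∑ γ^ν ψ ∧ D_ν f` by the Leibniz rule, `D^C ψ = 0` turns the derivative of `γ^ν ψ`
into `(D̂_u γ)(e^ν)ψ` up to Christoffel symbols of `∇`, which turn `D_u D_ν f` into the Hessian
of `f`; admissibility says that `(D̂_u γ)(Y)ψ = ½ 𝒯(u, Y)ψ`. In `ı(φ)ı(ψ) + ı(ψ)ı(φ)` the Hessian is
antisymmetrized because the spinors anticommute, and its antisymmetric part is the curvature. This
last fact is an identity between derivations `[D_u, D_v] - D_{[u, v]}` and `R(u, v)`, so it suffices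
to check it on functions and on sections of `S`, which generate the superfunctions locally. -/

noncomputable section

namespace SpinorSuper

section Algebra

variable {R : Type*} [CommRing R] {V W : Type*} [AddCommGroup V] [Module R V]
  [AddCommGroup W] [Module R W]

theorem ext_of_leibniz {T₁ T₂ : ExteriorAlgebra R V →ₗ[R] ExteriorAlgebra R V}
    (h₁ : ∀ a b, T₁ (a * b) = T₁ a * b + a * T₁ b) (h₂ : ∀ a b, T₂ (a * b) = T₂ a * b + a * T₂ b)
    (hι : ∀ v, T₁ (ExteriorAlgebra.ι R v) = T₂ (ExteriorAlgebra.ι R v)) : T₁ = T₂ := by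
  have map_one_eq_zero {T : ExteriorAlgebra R V →ₗ[R] ExteriorAlgebra R V}
      (h : ∀ a b, T (a * b) = T a * b + a * T b) : T 1 = 0 := by
    simpa using h 1 1
  refine LinearMap.ext fun a => ?_
  induction a using ExteriorAlgebra.induction with
  | algebraMap r =>
    rw [Algebra.algebraMap_eq_smul_one, map_smul, map_smul, map_one_eq_zero h₁, map_one_eq_zero h₂]
  | ι v => exact hι v
  | mul a b ha hb => rw [h₁, h₂, ha, hb]
  | add a b ha hb => rw [map_add, map_add, ha, hb]

theorem derivOfEnd_algebraMap (Φ : V →ₗ[R] V) (r : R) :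
    derivOfEnd Φ (algebraMap R (ExteriorAlgebra R V) r) = 0 := by
  simp [derivOfEnd, TrivSqZeroExt.algebraMap_eq_inl']

theorem derivOfEnd_add (Φ Ψ : V →ₗ[R] V) :
    derivOfEnd (Φ + Ψ) = derivOfEnd Φ + derivOfEnd Ψ :=
  ext_of_leibniz (derivOfEnd_mul _)
    (fun a b => by simp only [LinearMap.add_apply, derivOfEnd_mul]; noncomm_ring)
    (fun v => by simp [derivOfEnd_ι])

theorem derivOfEnd_smul (c : R) (Φ : V →ₗ[R] V) : derivOfEnd (c • Φ) = c • derivOfEnd Φ :=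
  ext_of_leibniz (derivOfEnd_mul _)
    (fun a b => by simp [derivOfEnd_mul])
    (fun v => by simp [derivOfEnd_ι])

theorem ι_mul_ι_mul_mem_evenOdd {p : ZMod 2} (v w : V) {a : ExteriorAlgebra R V}
    (ha : a ∈ CliffordAlgebra.evenOdd (0 : QuadraticForm R V) p) :
    ExteriorAlgebra.ι R v * ExteriorAlgebra.ι R w * a
      ∈ CliffordAlgebra.evenOdd (0 : QuadraticForm R V) p := by
  have h := SetLike.mul_mem_graded (SetLike.mul_mem_graded
    (CliffordAlgebra.ι_mem_evenOdd_one (0 : QuadraticForm R V) v)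
    (CliffordAlgebra.ι_mem_evenOdd_one _ w)) ha
  rwa [(by decide : ∀ p : ZMod 2, 1 + 1 + p = p) p] at h

theorem mem_evenOdd_induction {P : ZMod 2 → ExteriorAlgebra R V → Prop}
    (algebraMap : ∀ r, P 0 (algebraMap R _ r)) (ι : ∀ v, P 1 (ExteriorAlgebra.ι R v))
    (add : ∀ p a b, P p a → P p b → P p (a + b))
    (ι_mul_ι_mul : ∀ p v w a, a ∈ CliffordAlgebra.evenOdd (0 : QuadraticForm R V) p → P p a →
      P p (ExteriorAlgebra.ι R v * ExteriorAlgebra.ι R w * a))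
    {p : ZMod 2} {a : ExteriorAlgebra R V}
    (ha : a ∈ CliffordAlgebra.evenOdd (0 : QuadraticForm R V) p) : P p a := by
  induction a, ha using CliffordAlgebra.evenOdd_induction with
  | range_ι_pow v h =>
    obtain rfl | rfl : p = 0 ∨ p = 1 := (by decide : ∀ p : ZMod 2, p = 0 ∨ p = 1) p
    · rw [ZMod.val_zero, pow_zero] at h
      obtain ⟨r, rfl⟩ := Submodule.mem_one.1 h
      exact algebraMap r
    · rw [ZMod.val_one, pow_one] at h
      obtain ⟨v, rfl⟩ := h
      exact ι v
  | add a b _ _ iha ihb => exact add p a b iha ihb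
  | ι_mul_ι_mul v w a ha ih => exact ι_mul_ι_mul p v w a ha ih

theorem derivOfEnd_mem_evenOdd (Φ : V →ₗ[R] V) {p : ZMod 2} {a : ExteriorAlgebra R V}
    (ha : a ∈ CliffordAlgebra.evenOdd (0 : QuadraticForm R V) p) :
    derivOfEnd Φ a ∈ CliffordAlgebra.evenOdd (0 : QuadraticForm R V) p := by
  refine mem_evenOdd_induction
    (P := fun p a => derivOfEnd Φ a ∈ CliffordAlgebra.evenOdd 0 p)
    (fun r => ?_) (fun u => ?_) (fun p a b iha ihb => ?_) (fun p u w a ha ih => ?_) ha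
  · rw [derivOfEnd_algebraMap]
    exact Submodule.zero_mem _
  · rw [derivOfEnd_ι]
    exact CliffordAlgebra.ι_mem_evenOdd_one _ _
  · rw [map_add]
    exact Submodule.add_mem _ iha ihb
  · rw [derivOfEnd_mul, derivOfEnd_mul, derivOfEnd_ι, derivOfEnd_ι, add_mul]
    exact Submodule.add_mem _ (Submodule.add_mem _ (ι_mul_ι_mul_mem_evenOdd _ _ ha)
      (ι_mul_ι_mul_mem_evenOdd _ _ ha)) (ι_mul_ι_mul_mem_evenOdd _ _ ih)

theorem map_mem_evenOdd (T : V →ₗ[R] W) {p : ZMod 2} {a : ExteriorAlgebra R V}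
    (ha : a ∈ CliffordAlgebra.evenOdd (0 : QuadraticForm R V) p) :
    ExteriorAlgebra.map T a ∈ CliffordAlgebra.evenOdd (0 : QuadraticForm R W) p := by
  refine mem_evenOdd_induction
    (P := fun p a => ExteriorAlgebra.map T a ∈ CliffordAlgebra.evenOdd 0 p)
    (fun r => ?_) (fun u => ?_) (fun p a b iha ihb => ?_) (fun p u w a _ ih => ?_) ha
  · rw [AlgHom.commutes]
    exact SetLike.algebraMap_mem_graded _ r
  · rw [ExteriorAlgebra.map_apply_ι]
    exact CliffordAlgebra.ι_mem_evenOdd_one _ _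
  · rw [map_add]
    exact Submodule.add_mem _ iha ihb
  · simp only [map_mul, ExteriorAlgebra.map_apply_ι]
    exact ι_mul_ι_mul_mem_evenOdd _ _ ih

theorem ι_mul_ι_eq_neg (v w : V) :
    ExteriorAlgebra.ι R v * ExteriorAlgebra.ι R w
      = -(ExteriorAlgebra.ι R w * ExteriorAlgebra.ι R v) :=
  eq_neg_of_add_eq_zero_left (ExteriorAlgebra.ι_add_mul_swap v w)

theorem sum_ι_mul_ι_mul_add_swap {α : Type*} [Fintype α] (v w : α → V)
    (a : α → α → ExteriorAlgebra R V) :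
    ∑ i, ∑ j, ExteriorAlgebra.ι R (v i) * ExteriorAlgebra.ι R (w j) * a i j
        + ∑ i, ∑ j, ExteriorAlgebra.ι R (w i) * ExteriorAlgebra.ι R (v j) * a i j
      = ∑ i, ∑ j, ExteriorAlgebra.ι R (v i) * ExteriorAlgebra.ι R (w j) * (a i j - a j i) := by
  have swap : ∑ i, ∑ j, ExteriorAlgebra.ι R (w i) * ExteriorAlgebra.ι R (v j) * a i j
      = ∑ i, ∑ j, -(ExteriorAlgebra.ι R (v i) * ExteriorAlgebra.ι R (w j) * a j i) := by
    rw [Finset.sum_comm]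
    simp only [ι_mul_ι_eq_neg (w _) (v _), neg_mul]
  simp only [swap, mul_sub, Finset.sum_sub_distrib, Finset.sum_neg_distrib]
  exact (sub_eq_add_neg _ _).symm

theorem ι_mul_of_mem_evenOdd (v : V) {p : ZMod 2} {a : ExteriorAlgebra R V}
    (ha : a ∈ CliffordAlgebra.evenOdd (0 : QuadraticForm R V) p) :
    ExteriorAlgebra.ι R v * a = (-1 : R) ^ p.val • (a * ExteriorAlgebra.ι R v) := by
  refine mem_evenOdd_induction
    (P := fun p a =>
      ExteriorAlgebra.ι R v * a = (-1 : R) ^ p.val • (a * ExteriorAlgebra.ι R v))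
    (fun r => ?_) (fun u => ?_) (fun p a b iha ihb => ?_) (fun p u w a _ ih => ?_) ha
  · rw [ZMod.val_zero, pow_zero, one_smul]
    exact (Algebra.commutes r _).symm
  · rw [ZMod.val_one, pow_one, neg_one_smul]
    exact ι_mul_ι_eq_neg v u
  · rw [mul_add, iha, ihb, add_mul, smul_add]
  · have ι_comm_ι_mul_ι : ExteriorAlgebra.ι R v * (ExteriorAlgebra.ι R u * ExteriorAlgebra.ι R w)
        = ExteriorAlgebra.ι R u * ExteriorAlgebra.ι R w * ExteriorAlgebra.ι R v := by
      rw [← mul_assoc, ι_mul_ι_eq_neg v u, neg_mul, mul_assoc, ι_mul_ι_eq_neg v w, mul_neg,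
        neg_neg, mul_assoc]
    rw [← mul_assoc, ι_comm_ι_mul_ι, mul_assoc, ih, mul_smul_comm, mul_assoc _ a]

end Algebra

section Calculus

variable {E : Type*} [NormedAddCommGroup E] [NormedSpace ℝ E]
  {H : Type*} [TopologicalSpace H] {I : ModelWithCorners ℝ E H}
  {M : Type*} [TopologicalSpace M] [ChartedSpace H M]
  {V₁ V₂ V₃ : Type*} [NormedAddCommGroup V₁] [NormedSpace ℝ V₁]
  [NormedAddCommGroup V₂] [NormedSpace ℝ V₂] [NormedAddCommGroup V₃] [NormedSpace ℝ V₃]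

theorem mvfderiv_congr {a c : M → V₁} {x : M} (h : a =ᶠ[𝓝 x] c) :
    mvfderiv I a x = mvfderiv I c x := by
  ext v
  simp only [mvfderiv, h.mfderiv_eq, ContinuousLinearMap.comp_apply]
  rfl

theorem mvfderiv_clm_comp (L : V₁ →L[ℝ] V₂) {a : M → V₁} {x : M}
    (ha : MDifferentiableAt I 𝓘(ℝ, V₁) a x) (v : TangentSpace I x) :
    mvfderiv I (fun y => L (a y)) x v = L (mvfderiv I a x v) :=
  congrArg (fun T => T v) ((L.hasMFDerivAt (x := a x)).comp x ha.hasMFDerivAt).mfderiv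

theorem mvfderiv_clm_apply₂ (B : V₁ →L[ℝ] V₂ →L[ℝ] V₃) {a : M → V₁} {c : M → V₂} {x : M}
    (ha : MDifferentiableAt I 𝓘(ℝ, V₁) a x) (hc : MDifferentiableAt I 𝓘(ℝ, V₂) c x)
    (v : TangentSpace I x) :
    mvfderiv I (fun y => B (a y) (c y)) x v
      = B (mvfderiv I a x v) (c x) + B (a x) (mvfderiv I c x v) := by
  have h : HasMFDerivAt I 𝓘(ℝ, V₃) (fun y => B (a y) (c y)) x _ :=
    ⟨(B.continuous.continuousAt.comp ha.continuousAt).clm_apply hc.continuousAt,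
      B.hasFDerivWithinAt_of_bilinear ha.hasMFDerivAt.2 hc.hasMFDerivAt.2⟩
  refine (congrArg (fun T => T v) h.mfderiv).trans ((add_comm _ _).trans ?_)
  simp only [extChartAt_to_inv]
  rfl

end Calculus

section Coordinates

variable {𝕜 : Type*} [RCLike 𝕜]
  {E : Type*} [NormedAddCommGroup E] [NormedSpace ℝ E]
  {H : Type*} [TopologicalSpace H] {I : ModelWithCorners ℝ E H}
  {M : Type*} [TopologicalSpace M] [ChartedSpace H M]
  {V V₁ V₂ V₃ : Type*} [AddCommGroup V] [Module 𝕜 V] [AddCommGroup V₁] [Module 𝕜 V₁]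
  [AddCommGroup V₂] [Module 𝕜 V₂] [AddCommGroup V₃] [Module 𝕜 V₃]
  {κ κ₁ κ₂ κ₃ : Type*} [Fintype κ] [Fintype κ₁] [Fintype κ₂] [Fintype κ₃]

variable (I) in
/-- Smoothness at `x` of a map into a finite-dimensional `𝕜`-vector space without a chosen topology
(such as an exterior algebra), in terms of its coordinates with respect to a basis. -/
def CoordSmoothAt (b : Basis κ 𝕜 V) (a : M → V) (x : M) : Prop :=
  ContMDiffAt I 𝓘(ℝ, κ → 𝕜) ∞ (fun y => b.equivFun (a y)) x

/-- The derivative at `x` in the direction `v` of a map into a finite-dimensional `𝕜`-vector space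
without a chosen topology, in terms of its coordinates with respect to a basis. -/
def coordDeriv (b : Basis κ 𝕜 V) (a : M → V) (x : M) (v : TangentSpace I x) : V :=
  b.equivFun.symm (mvfderiv I (fun y => b.equivFun (a y)) x v)

theorem coordSmoothAt_iff_repr {b : Basis κ 𝕜 V} {a : M → V} {x : M} :
    CoordSmoothAt I b a x ↔ ∀ i, ContMDiffAt I 𝓘(ℝ, 𝕜) ∞ (fun y => b.repr (a y) i) x :=
  contMDiffAt_pi_space

theorem CoordSmoothAt.mdifferentiableAt {b : Basis κ 𝕜 V} {a : M → V} {x : M}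
    (h : CoordSmoothAt I b a x) :
    MDifferentiableAt I 𝓘(ℝ, κ → 𝕜) (fun y => b.equivFun (a y)) x :=
  ContMDiffAt.mdifferentiableAt h (by simp)

theorem CoordSmoothAt.coordDeriv_eq_sum {b : Basis κ 𝕜 V} {a : M → V} {x : M}
    (h : CoordSmoothAt I b a x) (v : TangentSpace I x) :
    coordDeriv b a x v = ∑ i, mvfderiv I (fun y => b.repr (a y) i) x v • b i := by
  rw [coordDeriv, b.equivFun_symm_apply]
  exact Finset.sum_congr rfl fun i _ => congrArg (· • b i)
    (mvfderiv_clm_comp (ContinuousLinearMap.proj i) h.mdifferentiableAt v).symm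

theorem CoordSmoothAt.congr {b : Basis κ 𝕜 V} {a c : M → V} {x : M}
    (h : CoordSmoothAt I b a x) (hac : c =ᶠ[𝓝 x] a) : CoordSmoothAt I b c x :=
  ContMDiffAt.congr_of_eventuallyEq h (hac.fun_comp b.equivFun)

theorem coordDeriv_congr (b : Basis κ 𝕜 V) {a c : M → V} {x : M} (hac : c =ᶠ[𝓝 x] a)
    (v : TangentSpace I x) : coordDeriv b c x v = coordDeriv b a x v := by
  rw [coordDeriv, coordDeriv, mvfderiv_congr (hac.mono fun y hy => congrArg b.equivFun hy)]

theorem CoordSmoothAt.linear {b₁ : Basis κ₁ 𝕜 V₁} (b₂ : Basis κ₂ 𝕜 V₂) (T : V₁ →ₗ[𝕜] V₂)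
    {a : M → V₁} {x : M} (ha : CoordSmoothAt I b₁ a x) :
    CoordSmoothAt I b₂ (fun y => T (a y)) x := by
  let L := (b₂.equivFun.toLinearMap ∘ₗ T ∘ₗ b₁.equivFun.symm.toLinearMap).toContinuousLinearMap
    |>.restrictScalars ℝ
  exact (L.contDiff.contMDiff.contMDiffAt.comp x ha).congr_of_eventuallyEq
    (.of_forall fun y => by simp [L])

theorem coordDeriv_linear {b₁ : Basis κ₁ 𝕜 V₁} (b₂ : Basis κ₂ 𝕜 V₂) (T : V₁ →ₗ[𝕜] V₂)
    {a : M → V₁} {x : M} (ha : CoordSmoothAt I b₁ a x) (v : TangentSpace I x) :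
    coordDeriv b₂ (fun y => T (a y)) x v = T (coordDeriv b₁ a x v) := by
  let L := (b₂.equivFun.toLinearMap ∘ₗ T ∘ₗ b₁.equivFun.symm.toLinearMap).toContinuousLinearMap
    |>.restrictScalars ℝ
  have hL : (fun y => b₂.equivFun (T (a y))) = fun y => L (b₁.equivFun (a y)) := by
    funext y
    simp [L]
  rw [coordDeriv, hL, mvfderiv_clm_comp L ha.mdifferentiableAt, LinearEquiv.symm_apply_eq]
  rfl

/-- A `𝕜`-bilinear map in coordinates, as a continuous real bilinear map. -/
def coordBilin (b₁ : Basis κ₁ 𝕜 V₁) (b₂ : Basis κ₂ 𝕜 V₂) (b₃ : Basis κ₃ 𝕜 V₃)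
    (B : V₁ →ₗ[𝕜] V₂ →ₗ[𝕜] V₃) : (κ₁ → 𝕜) →L[ℝ] (κ₂ → 𝕜) →L[ℝ] (κ₃ → 𝕜) :=
  (((B.compl₁₂ b₁.equivFun.symm.toLinearMap b₂.equivFun.symm.toLinearMap).compr₂
    b₃.equivFun.toLinearMap).toContinuousBilinearMap).bilinearRestrictScalars ℝ

theorem coordBilin_apply (b₁ : Basis κ₁ 𝕜 V₁) (b₂ : Basis κ₂ 𝕜 V₂) (b₃ : Basis κ₃ 𝕜 V₃)
    (B : V₁ →ₗ[𝕜] V₂ →ₗ[𝕜] V₃) (u : κ₁ → 𝕜) (w : κ₂ → 𝕜) :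
    coordBilin b₁ b₂ b₃ B u w = b₃.equivFun (B (b₁.equivFun.symm u) (b₂.equivFun.symm w)) := rfl

theorem CoordSmoothAt.bilin {b₁ : Basis κ₁ 𝕜 V₁} {b₂ : Basis κ₂ 𝕜 V₂} (b₃ : Basis κ₃ 𝕜 V₃)
    (B : V₁ →ₗ[𝕜] V₂ →ₗ[𝕜] V₃) {a : M → V₁} {c : M → V₂} {x : M}
    (ha : CoordSmoothAt I b₁ a x) (hc : CoordSmoothAt I b₂ c x) :
    CoordSmoothAt I b₃ (fun y => B (a y) (c y)) x := by
  have h := (coordBilin b₁ b₂ b₃ B).isBoundedBilinearMap.contDiff.contMDiff.contMDiffAt.comp x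
    (ContMDiffAt.prodMk_space ha hc)
  exact h.congr_of_eventuallyEq (.of_forall fun y => by
    simp only [Function.comp_apply, coordBilin_apply, LinearEquiv.symm_apply_apply])

theorem coordDeriv_bilin {b₁ : Basis κ₁ 𝕜 V₁} {b₂ : Basis κ₂ 𝕜 V₂} (b₃ : Basis κ₃ 𝕜 V₃)
    (B : V₁ →ₗ[𝕜] V₂ →ₗ[𝕜] V₃) {a : M → V₁} {c : M → V₂} {x : M}
    (ha : CoordSmoothAt I b₁ a x) (hc : CoordSmoothAt I b₂ c x) (v : TangentSpace I x) :
    coordDeriv b₃ (fun y => B (a y) (c y)) x v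
      = B (coordDeriv b₁ a x v) (c x) + B (a x) (coordDeriv b₂ c x v) := by
  have hB : (fun y => b₃.equivFun (B (a y) (c y)))
      = fun y => coordBilin b₁ b₂ b₃ B (b₁.equivFun (a y)) (b₂.equivFun (c y)) := by
    simp only [coordBilin_apply, LinearEquiv.symm_apply_apply]
  rw [coordDeriv, hB, mvfderiv_clm_apply₂ _ ha.mdifferentiableAt hc.mdifferentiableAt,
    coordBilin_apply, coordBilin_apply, ← map_add, LinearEquiv.symm_apply_apply,
    LinearEquiv.symm_apply_apply, LinearEquiv.symm_apply_apply]
  rfl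

theorem CoordSmoothAt.add {b : Basis κ 𝕜 V} {a c : M → V} {x : M} (ha : CoordSmoothAt I b a x)
    (hc : CoordSmoothAt I b c x) : CoordSmoothAt I b (fun y => a y + c y) x := by
  simp only [CoordSmoothAt, map_add]
  exact ContMDiffAt.add ha hc

theorem CoordSmoothAt.sum {b : Basis κ 𝕜 V} {α : Type*} {s : Finset α} {a : α → M → V} {x : M}
    (ha : ∀ i ∈ s, CoordSmoothAt I b (a i) x) :
    CoordSmoothAt I b (fun y => ∑ i ∈ s, a i y) x := by
  simp only [CoordSmoothAt, map_sum]
  exact contMDiffAt_finsetSum ha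

theorem coordDeriv_add {b : Basis κ 𝕜 V} {a c : M → V} {x : M} (ha : CoordSmoothAt I b a x)
    (hc : CoordSmoothAt I b c x) (v : TangentSpace I x) :
    coordDeriv b (fun y => a y + c y) x v = coordDeriv b a x v + coordDeriv b c x v := by
  simp only [coordDeriv, map_add]
  rw [mvfderiv_fun_add ha.mdifferentiableAt hc.mdifferentiableAt, ← map_add]
  rfl

theorem coordDeriv_mem (b : Basis κ 𝕜 V) (N : Submodule 𝕜 V) {a : M → V} {x : M}
    (ha : CoordSmoothAt I b a x) (hN : ∀ᶠ y in 𝓝 x, a y ∈ N) (v : TangentSpace I x) :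
    coordDeriv b a x v ∈ N := by
  by_contra h
  obtain ⟨l, hl, hlN⟩ := Submodule.exists_le_ker_of_notMem h
  refine hl ((coordDeriv_linear (Basis.singleton Unit 𝕜) l ha v).symm.trans ?_)
  rw [coordDeriv_congr _ (a := fun _ => 0) (hN.mono fun y hy => hlN hy), coordDeriv, mvfderiv_const]
  simp

theorem coordSmoothAt_singleton {a : M → 𝕜} {x : M} (ha : ContMDiffAt I 𝓘(ℝ, 𝕜) ∞ a x) :
    CoordSmoothAt I (Basis.singleton Unit 𝕜) a x :=
  coordSmoothAt_iff_repr.2 fun _ => by simpa using ha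

theorem coordDeriv_singleton {a : M → 𝕜} {x : M} (ha : ContMDiffAt I 𝓘(ℝ, 𝕜) ∞ a x)
    (v : TangentSpace I x) : coordDeriv (Basis.singleton Unit 𝕜) a x v = mvfderiv I a x v := by
  rw [(coordSmoothAt_singleton ha).coordDeriv_eq_sum]
  simp

theorem coordSmoothAt_basis_iff {F : Type*} [NormedAddCommGroup F] [NormedSpace ℝ F]
    [NormedSpace 𝕜 F] [IsScalarTower ℝ 𝕜 F] {b : Basis κ 𝕜 F} {a : M → F} {x : M} :
    CoordSmoothAt I b a x ↔ ContMDiffAt I 𝓘(ℝ, F) ∞ a x := by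
  let L : F →L[ℝ] (κ → 𝕜) := b.equivFunL.toContinuousLinearMap.restrictScalars ℝ
  let L' : (κ → 𝕜) →L[ℝ] F := b.equivFunL.symm.toContinuousLinearMap.restrictScalars ℝ
  refine ⟨fun h => ?_, fun h => L.contDiff.contMDiff.contMDiffAt.comp x h⟩
  exact (L'.contDiff.contMDiff.contMDiffAt.comp x h).congr_of_eventuallyEq
    (.of_forall fun y => (b.equivFun.symm_apply_apply (a y)).symm)

end Coordinates

section CovariantDerivative

variable {E : Type*} [NormedAddCommGroup E] [NormedSpace ℝ E]
  {H : Type*} [TopologicalSpace H] {I : ModelWithCorners ℝ E H}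
  {M : Type*} [TopologicalSpace M] [ChartedSpace H M]
  {F : Type*} [NormedAddCommGroup F] [NormedSpace ℝ F]
  {S : M → Type*} [TopologicalSpace (TotalSpace F S)]
  [∀ x, AddCommGroup (S x)] [∀ x, Module ℝ (S x)] [∀ x, TopologicalSpace (S x)]
  [∀ x, IsTopologicalAddGroup (S x)] [∀ x, ContinuousSMul ℝ (S x)]
  [FiberBundle F S]

theorem covariantDerivative_congr (D : CovariantDerivative I F S) {σ τ : Π x : M, S x} {x : M}
    (hτ : MDifferentiableAt I (I.prod 𝓘(ℝ, F)) (fun y ↦ TotalSpace.mk' F y (τ y)) x)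
    (h : ∀ᶠ y in 𝓝 x, σ y = τ y) : D.toFun σ x = D.toFun τ x :=
  D.isCovariantDerivativeOnUniv.congr_of_eventuallyEq
    (hτ.congr_of_eventuallyEq (h.mono fun y hy => by simp only [hy])) hτ Filter.univ_mem h

theorem covariantDerivative_sum [VectorBundle ℝ F S] (D : CovariantDerivative I F S)
    {α : Type*} (s : Finset α) {σ : α → Π x : M, S x} {x : M}
    (hσ : ∀ i ∈ s, MDifferentiableAt I (I.prod 𝓘(ℝ, F)) (fun y ↦ TotalSpace.mk' F y (σ i y)) x)
    (v : TangentSpace I x) :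
    D.toFun (fun y => ∑ i ∈ s, σ i y) x v = ∑ i ∈ s, D.toFun (σ i) x v := by
  have hD := D.isCovariantDerivativeOnUniv
  classical
  induction s using Finset.induction_on with
  | empty =>
    simp only [Finset.sum_empty]
    exact congrArg (fun T => T v) (hD.zero (Set.mem_univ x))
  | insert i s hi ih =>
    have hs := fun j hj => hσ j (Finset.mem_insert_of_mem hj)
    simp only [Finset.sum_insert hi]
    rw [← ih hs]
    exact congrArg (fun T => T v) (hD.add (hσ i (Finset.mem_insert_self i s))
      (MDifferentiableAt.sum_section hs))

end CovariantDerivative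

section Sections

variable {𝕜 : Type*} [RCLike 𝕜]
  {E : Type*} [NormedAddCommGroup E] [NormedSpace ℝ E]
  {H : Type*} [TopologicalSpace H] {I : ModelWithCorners ℝ E H}
  {M : Type*} [TopologicalSpace M] [ChartedSpace H M]
  {F : Type*} [NormedAddCommGroup F] [NormedSpace 𝕜 F]
  {S : M → Type*} [TopologicalSpace (TotalSpace F S)]
  [∀ x, AddCommGroup (S x)] [∀ x, Module 𝕜 (S x)] [∀ x, TopologicalSpace (S x)]
  [FiberBundle F S] [VectorBundle 𝕜 F S]

theorem localExt_symmₗ (x y : M) (w : F) :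
    localExt 𝕜 F ((trivializationAt F S x).symmₗ 𝕜 x w) y
      = (trivializationAt F S x).symmₗ 𝕜 y w := by
  rw [localExt, Trivialization.linearMapAt_symmₗ _ (FiberBundle.mem_baseSet_trivializationAt' x)]

variable [NormedSpace ℝ F]

theorem contMDiffAt_symmₗ_section [∀ x, Module ℝ (S x)] [VectorBundle ℝ F S]
    [ContMDiffVectorBundle ∞ F S I] (x₀ : M) {y : M} (hy : y ∈ (trivializationAt F S x₀).baseSet)
    (w : F) : ContMDiffAt I (I.prod 𝓘(ℝ, F)) ∞
      (fun z ↦ TotalSpace.mk' F z ((trivializationAt F S x₀).symmₗ 𝕜 z w)) y := by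
  rw [Trivialization.contMDiffAt_section_iff _ hy]
  refine (contMDiffAt_const (c := w)).congr_of_eventuallyEq ?_
  filter_upwards [(trivializationAt F S x₀).open_baseSet.mem_nhds hy] with z hz
  have h := Trivialization.linearMapAt_symmₗ (R := 𝕜) (trivializationAt F S x₀) hz w
  rwa [Trivialization.coe_linearMapAt_of_mem _ hz] at h

theorem connectionForm_add [∀ x, Module ℝ (S x)] [VectorBundle ℝ F S]
    [∀ x, IsTopologicalAddGroup (S x)] [∀ x, ContinuousSMul ℝ (S x)] [IsManifold I ∞ M]
    [ContMDiffVectorBundle ∞ F S I] (D : SpinorConnection 𝕜 I F S) (x : M)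
    (u v : TangentSpace I x) :
    connectionForm D x (u + v) = connectionForm D x u + connectionForm D x v := by
  ext s
  exact map_add (D.toFun (localExt 𝕜 F s) x) u v

variable [IsScalarTower ℝ 𝕜 F]

theorem mdifferentiableAt_smul_fun_section {a : M → 𝕜} {σ : Π x : M, S x} {x : M}
    (ha : MDifferentiableAt I 𝓘(ℝ, 𝕜) a x)
    (hσ : MDifferentiableAt I (I.prod 𝓘(ℝ, F)) (fun y ↦ TotalSpace.mk' F y (σ y)) x) :
    MDifferentiableAt I (I.prod 𝓘(ℝ, F)) (fun y ↦ TotalSpace.mk' F y (a y • σ y)) x := by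
  rw [mdifferentiableAt_section] at hσ ⊢
  have h := (ContinuousLinearMap.lsmul ℝ 𝕜 (E := F)).isBoundedBilinearMap.differentiableAt
    _ |>.mdifferentiableAt.comp x (ha.prodMk_space hσ)
  refine h.congr_of_eventuallyEq ?_
  filter_upwards [(trivializationAt F S x).open_baseSet.mem_nhds
    (FiberBundle.mem_baseSet_trivializationAt' x)] with y hy
  exact (Trivialization.linear 𝕜 (trivializationAt F S x) hy).map_smul (a y) (σ y)

variable [∀ x, Module ℝ (S x)]

variable (F) in
theorem ofReal_smul_fibre [VectorBundle ℝ F S] (x : M) (r : ℝ) (s : S x) :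
    (r : 𝕜) • s = r • s := by
  have hx := FiberBundle.mem_baseSet_trivializationAt F S x
  apply ((trivializationAt F S x).linearEquivAt 𝕜 x hx).injective
  rw [map_smul, ← RCLike.real_smul_eq_coe_smul]
  exact ((Trivialization.linear ℝ (trivializationAt F S x) hx).map_smul r s).symm

variable [VectorBundle ℝ F S]

theorem coordSmoothAt_section_iff [ContMDiffVectorBundle ∞ F S I]
    {κ : Type*} [Fintype κ] {b : Basis κ 𝕜 F} {σ : Π x : M, S x} {x₀ y : M}
    (hy : y ∈ (trivializationAt F S x₀).baseSet) :
    CoordSmoothAt I b (fun z => (trivializationAt F S x₀).linearMapAt 𝕜 z (σ z)) y ↔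
      ContMDiffAt I (I.prod 𝓘(ℝ, F)) ∞ (fun z ↦ TotalSpace.mk' F z (σ z)) y := by
  rw [coordSmoothAt_basis_iff, Trivialization.contMDiffAt_section_iff _ hy]
  refine Filter.EventuallyEq.contMDiffAt_iff ?_
  filter_upwards [(trivializationAt F S x₀).open_baseSet.mem_nhds hy] with z hz
  rw [Trivialization.coe_linearMapAt_of_mem _ hz]

section Connection

variable [∀ x, IsTopologicalAddGroup (S x)] [∀ x, ContinuousSMul ℝ (S x)]
  [IsManifold I ∞ M] [ContMDiffVectorBundle ∞ F S I]

theorem connectionForm_smul (D : SpinorConnection 𝕜 I F S) (x : M) (r : ℝ) (v : TangentSpace I x) :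
    connectionForm D x (r • v) = (r : 𝕜) • connectionForm D x v := by
  ext s
  rw [LinearMap.smul_apply, ofReal_smul_fibre F]
  exact map_smul (D.toFun (localExt 𝕜 F s) x) r v

-- Splitting `a` into real and imaginary parts reduces this to the real Leibniz rule of `D` and its
-- `𝕜`-linearity.
theorem SpinorConnection.leibniz_smul (D : SpinorConnection 𝕜 I F S) {a : M → 𝕜}
    {σ : Π x : M, S x} {x : M} (ha : MDifferentiableAt I 𝓘(ℝ, 𝕜) a x)
    (hσ : MDifferentiableAt I (I.prod 𝓘(ℝ, F)) (fun y ↦ TotalSpace.mk' F y (σ y)) x)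
    (v : TangentSpace I x) :
    D.toFun (fun y => a y • σ y) x v = a x • D.toFun σ x v + mvfderiv I a x v • σ x := by
  let re : M → ℝ := fun y => RCLike.reCLM (a y)
  let im : M → ℝ := fun y => RCLike.imCLM (a y)
  have hre : MDifferentiableAt I 𝓘(ℝ, ℝ) re x :=
    RCLike.reCLM.differentiableAt.comp_mdifferentiableAt ha
  have him : MDifferentiableAt I 𝓘(ℝ, ℝ) im x :=
    RCLike.imCLM.differentiableAt.comp_mdifferentiableAt ha
  have hI := mdifferentiableAt_smul_section (RCLike.I : 𝕜) hσ
  have re_add_im : (fun y => a y • σ y) = re • σ + im • ((RCLike.I : 𝕜) • σ) := by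
    funext y
    change a y • σ y = RCLike.re (a y) • σ y + RCLike.im (a y) • ((RCLike.I : 𝕜) • σ y)
    rw [← ofReal_smul_fibre (𝕜 := 𝕜) F y, ← ofReal_smul_fibre (𝕜 := 𝕜) F y, smul_smul, ← add_smul,
      RCLike.re_add_im]
  have hD := D.isCovariantDerivativeOnUniv
  rw [re_add_im, hD.add (hre.smul_section hσ) (him.smul_section hI), hD.leibniz hσ hre,
    hD.leibniz hI him]
  simp only [add_apply, smul_apply, ContinuousLinearMap.smulRight_apply]
  rw [D.map_smul x _ σ hσ v, mvfderiv_clm_comp RCLike.reCLM ha, mvfderiv_clm_comp RCLike.imCLM ha]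
  change RCLike.re (a x) • D.toFun σ x v + RCLike.re (mvfderiv I a x v) • σ x
    + (RCLike.im (a x) • (RCLike.I : 𝕜) • D.toFun σ x v
      + RCLike.im (mvfderiv I a x v) • (RCLike.I : 𝕜) • σ x) = _
  simp only [← ofReal_smul_fibre (𝕜 := 𝕜) F x, smul_smul]
  conv_rhs => rw [← RCLike.re_add_im (a x), ← RCLike.re_add_im (mvfderiv I a x v)]
  module

theorem SpinorConnection.apply_eq_coordDeriv_add_connectionForm [FiniteDimensional 𝕜 F]
    {κ : Type*} [Fintype κ] (b : Basis κ 𝕜 F) (D : SpinorConnection 𝕜 I F S)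
    {σ : Π x : M, S x} {x : M}
    (hσ : ContMDiffAt I (I.prod 𝓘(ℝ, F)) ∞ (fun y ↦ TotalSpace.mk' F y (σ y)) x)
    (v : TangentSpace I x) :
    D.toFun σ x v
      = (trivializationAt F S x).symmₗ 𝕜 x
          (coordDeriv b (fun y => (trivializationAt F S x).linearMapAt 𝕜 y (σ y)) x v)
        + connectionForm D x v (σ x) := by
  have hx : x ∈ (trivializationAt F S x).baseSet := FiberBundle.mem_baseSet_trivializationAt' x
  let c := fun k y => b.repr ((trivializationAt F S x).linearMapAt 𝕜 y (σ y)) k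
  let θ := fun k => localExt 𝕜 F ((trivializationAt F S x).symmₗ 𝕜 x (b k))
  have hcoord : CoordSmoothAt I b _ x := (coordSmoothAt_section_iff hx).2 hσ
  have hc : ∀ k, MDifferentiableAt I 𝓘(ℝ, 𝕜) (c k) x := fun k =>
    (coordSmoothAt_iff_repr.1 hcoord k).mdifferentiableAt (by simp)
  have hθ : ∀ k, MDifferentiableAt I (I.prod 𝓘(ℝ, F)) (fun y ↦ TotalSpace.mk' F y (θ k y)) x :=
    fun k => mdifferentiableAt_localExt 𝕜 F _
  have hcθ := fun k => mdifferentiableAt_smul_fun_section (hc k) (hθ k)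
  have eq_sum : ∀ᶠ y in 𝓝 x, σ y = ∑ k, c k y • θ k y := by
    filter_upwards [(trivializationAt F S x).open_baseSet.mem_nhds hx] with y hy
    simp only [θ, localExt_symmₗ, c, ← _root_.map_smul, ← map_sum]
    rw [b.sum_repr, Trivialization.symmₗ_linearMapAt _ hy]
  have leibniz_sum : D.toFun σ x v
      = ∑ k, (c k x • D.toFun (θ k) x v + mvfderiv I (c k) x v • θ k x) := by
    rw [covariantDerivative_congr _ (MDifferentiableAt.sum_section fun k _ => hcθ k) eq_sum,
      covariantDerivative_sum _ _ fun k _ => hcθ k]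
    exact Finset.sum_congr rfl fun k _ => D.leibniz_smul (hc k) (hθ k) v
  have connectionForm_eq_sum :
      connectionForm D x v (σ x) = ∑ k, c k x • D.toFun (θ k) x v := by
    rw [eq_sum.self_of_nhds, map_sum]
    simp only [_root_.map_smul, θ, localExt_self]
    rfl
  rw [leibniz_sum, Finset.sum_add_distrib, add_comm, connectionForm_eq_sum,
    hcoord.coordDeriv_eq_sum, map_sum]
  simp only [_root_.map_smul, θ, localExt_self]
  rfl

end Connection

end Sections

section Superfunctions

variable {𝕜 : Type*} [RCLike 𝕜]
  {E : Type*} [NormedAddCommGroup E] [NormedSpace ℝ E]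
  {H : Type*} [TopologicalSpace H] {I : ModelWithCorners ℝ E H}
  {M : Type*} [TopologicalSpace M] [ChartedSpace H M]
  {F : Type*} [NormedAddCommGroup F] [NormedSpace 𝕜 F]
  {S : M → Type*} [TopologicalSpace (TotalSpace F S)]
  [∀ x, AddCommGroup (S x)] [∀ x, Module 𝕜 (S x)] [∀ x, TopologicalSpace (S x)]
  [FiberBundle F S] [VectorBundle 𝕜 F S]

variable (F) in
/-- A section of `ΛS` in the preferred trivialization at `x₀`, with values in the exterior algebra
of the model fibre; outside the base set only its scalar part is retained. -/
def superCoord (x₀ : M) (f : Π x, ExteriorAlgebra 𝕜 (S x)) (y : M) : ExteriorAlgebra 𝕜 F :=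
  ExteriorAlgebra.map ((trivializationAt F S x₀).linearMapAt 𝕜 y) (f y)

theorem superCoord_add (x₀ : M) (f h : Π x, ExteriorAlgebra 𝕜 (S x)) :
    superCoord F x₀ (f + h) = fun y => superCoord F x₀ f y + superCoord F x₀ h y :=
  funext fun _ => map_add _ _ _

theorem superCoord_sum (x₀ : M) {α : Type*} (s : Finset α) (f : α → Π x, ExteriorAlgebra 𝕜 (S x)) :
    superCoord F x₀ (fun y => ∑ i ∈ s, f i y) = fun y => ∑ i ∈ s, superCoord F x₀ (f i) y :=
  funext fun _ => map_sum _ _ _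

theorem superCoord_mul (x₀ : M) (f h : Π x, ExteriorAlgebra 𝕜 (S x)) :
    superCoord F x₀ (f * h) = fun y => superCoord F x₀ f y * superCoord F x₀ h y :=
  funext fun _ => map_mul _ _ _

theorem superCoord_algebraMap (x₀ : M) (a : M → 𝕜) :
    superCoord F x₀ (fun y => algebraMap 𝕜 (ExteriorAlgebra 𝕜 (S y)) (a y))
      = fun y => Algebra.linearMap 𝕜 (ExteriorAlgebra 𝕜 F) (a y) :=
  funext fun _ => AlgHom.commutes _ _

theorem superCoord_ι (x₀ : M) (σ : Π x, S x) :
    superCoord F x₀ (fun y => ExteriorAlgebra.ι 𝕜 (σ y))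
      = fun y => ExteriorAlgebra.ι 𝕜 ((trivializationAt F S x₀).linearMapAt 𝕜 y (σ y)) :=
  funext fun _ => ExteriorAlgebra.map_apply_ι _ _

theorem superCoord_congr {x₀ x : M} {f h : Π x, ExteriorAlgebra 𝕜 (S x)}
    (hfh : ∀ᶠ y in 𝓝 x, f y = h y) : superCoord F x₀ f =ᶠ[𝓝 x] superCoord F x₀ h :=
  hfh.mono fun y hy => by simp only [superCoord, hy]

theorem map_symm_superCoord {x₀ y : M} (hy : y ∈ (trivializationAt F S x₀).baseSet)
    (f : Π x, ExteriorAlgebra 𝕜 (S x)) :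
    ExteriorAlgebra.map ((trivializationAt F S x₀).symmₗ 𝕜 y) (superCoord F x₀ f y) = f y := by
  rw [superCoord, ← AlgHom.comp_apply, ExteriorAlgebra.map_comp_map]
  have h : (trivializationAt F S x₀).symmₗ 𝕜 y ∘ₗ (trivializationAt F S x₀).linearMapAt 𝕜 y
      = LinearMap.id := by
    ext s
    exact Trivialization.symmₗ_linearMapAt _ hy s
  rw [h, ExteriorAlgebra.map_id]
  rfl

variable [FiniteDimensional 𝕜 F]

variable (I F) in
/-- Smoothness of a section of `ΛS` at a point; the local form of `IsSuperfunction`. -/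
def SmoothSuperAt (f : Π x, ExteriorAlgebra 𝕜 (S x)) (x : M) : Prop :=
  CoordSmoothAt I (finBasis 𝕜 F).ExteriorAlgebra (superCoord F x f) x

theorem isSuperfunction_iff {f : Π x, ExteriorAlgebra 𝕜 (S x)} :
    IsSuperfunction I F f ↔ ∀ x, SmoothSuperAt I F f x :=
  forall_congr' fun _ => coordSmoothAt_iff_repr.symm

theorem map_symm_eq_sum (x : M) {y : M} (hy : y ∈ (trivializationAt F S x).baseSet)
    (f : Π x, ExteriorAlgebra 𝕜 (S x)) :
    f y = ∑ A, algebraMap 𝕜 _ ((finBasis 𝕜 F).ExteriorAlgebra.repr (superCoord F x f y) A) *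
      ExteriorAlgebra.map ((trivializationAt F S x).symmₗ 𝕜 y)
        ((finBasis 𝕜 F).ExteriorAlgebra A) := by
  conv_lhs => rw [← map_symm_superCoord hy f,
    ← (finBasis 𝕜 F).ExteriorAlgebra.sum_repr (superCoord F x f y)]
  simp only [map_sum, map_smul]
  exact Finset.sum_congr rfl fun A _ => Algebra.smul_def _ _

theorem coordSmoothAt_superCoord_algebraMap {a : M → 𝕜} (x₀ : M) {y : M}
    (ha : ContMDiffAt I 𝓘(ℝ, 𝕜) ∞ a y) :
    CoordSmoothAt I (finBasis 𝕜 F).ExteriorAlgebra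
      (superCoord F x₀ (fun y => algebraMap 𝕜 (ExteriorAlgebra 𝕜 (S y)) (a y))) y := by
  rw [superCoord_algebraMap]
  exact (coordSmoothAt_singleton ha).linear (finBasis 𝕜 F).ExteriorAlgebra
    (Algebra.linearMap 𝕜 (ExteriorAlgebra 𝕜 F))

theorem coordSmoothAt_superCoord_mul {f h : Π x, ExteriorAlgebra 𝕜 (S x)} {x₀ y : M}
    (hf : CoordSmoothAt I (finBasis 𝕜 F).ExteriorAlgebra (superCoord F x₀ f) y)
    (hh : CoordSmoothAt I (finBasis 𝕜 F).ExteriorAlgebra (superCoord F x₀ h) y) :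
    CoordSmoothAt I (finBasis 𝕜 F).ExteriorAlgebra (superCoord F x₀ (f * h)) y := by
  rw [superCoord_mul]
  exact hf.bilin (finBasis 𝕜 F).ExteriorAlgebra (LinearMap.mul 𝕜 (ExteriorAlgebra 𝕜 F)) hh

section SmoothSuperAt

variable {f h : Π x, ExteriorAlgebra 𝕜 (S x)} {x : M}

theorem SmoothSuperAt.add (hf : SmoothSuperAt I F f x) (hh : SmoothSuperAt I F h x) :
    SmoothSuperAt I F (f + h) x := by
  rw [SmoothSuperAt, superCoord_add]
  exact CoordSmoothAt.add hf hh

theorem SmoothSuperAt.sum {α : Type*} {s : Finset α} {f : α → Π x, ExteriorAlgebra 𝕜 (S x)}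
    (hf : ∀ i ∈ s, SmoothSuperAt I F (f i) x) :
    SmoothSuperAt I F (fun y => ∑ i ∈ s, f i y) x := by
  rw [SmoothSuperAt, superCoord_sum]
  exact CoordSmoothAt.sum hf

theorem SmoothSuperAt.mul (hf : SmoothSuperAt I F f x) (hh : SmoothSuperAt I F h x) :
    SmoothSuperAt I F (f * h) x := coordSmoothAt_superCoord_mul hf hh

theorem SmoothSuperAt.congr (hf : SmoothSuperAt I F f x) (hfh : ∀ᶠ y in 𝓝 x, h y = f y) :
    SmoothSuperAt I F h x := CoordSmoothAt.congr hf (superCoord_congr hfh)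

theorem SmoothSuperAt.of_scalar {a : M → 𝕜} (ha : ContMDiffAt I 𝓘(ℝ, 𝕜) ∞ a x) :
    SmoothSuperAt I F (fun y => algebraMap 𝕜 (ExteriorAlgebra 𝕜 (S y)) (a y)) x :=
  coordSmoothAt_superCoord_algebraMap x ha

end SmoothSuperAt

variable [NormedSpace ℝ F] [∀ x, Module ℝ (S x)] [VectorBundle ℝ F S]
  [ContMDiffVectorBundle ∞ F S I]

section Derivative

variable [∀ x, IsTopologicalAddGroup (S x)] [∀ x, ContinuousSMul ℝ (S x)] [IsManifold I ∞ M]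
  (D : SpinorConnection 𝕜 I F S) {f h : Π x, ExteriorAlgebra 𝕜 (S x)} {x : M}

theorem superD_eq (hf : SmoothSuperAt I F f x) (v : TangentSpace I x) :
    superD D f x v = ExteriorAlgebra.map ((trivializationAt F S x).symmₗ 𝕜 x)
        (coordDeriv (finBasis 𝕜 F).ExteriorAlgebra (superCoord F x f) x v)
      + derivOfEnd (connectionForm D x v) (f x) := by
  rw [superD, CoordSmoothAt.coordDeriv_eq_sum hf, map_sum]
  simp only [map_smul]
  rfl

theorem superD_congr (hfh : ∀ᶠ y in 𝓝 x, f y = h y) (v : TangentSpace I x) :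
    superD D f x v = superD D h x v := by
  have hcoeff (A) : coeff (F := F) x f A =ᶠ[𝓝 x] coeff x h A :=
    hfh.mono fun y hy => by simp only [coeff, hy]
  simp only [superD, hfh.self_of_nhds, mvfderiv_congr (hcoeff _)]

theorem superD_mem_evenOdd {p : ZMod 2} (hf : SmoothSuperAt I F f x) (hp : IsHomogeneous p f)
    (v : TangentSpace I x) :
    superD D f x v ∈ CliffordAlgebra.evenOdd (0 : QuadraticForm 𝕜 (S x)) p := by
  rw [superD_eq D hf]
  refine Submodule.add_mem _ (map_mem_evenOdd _ ?_) (derivOfEnd_mem_evenOdd _ (hp x))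
  exact coordDeriv_mem _ _ hf (Filter.Eventually.of_forall fun y => map_mem_evenOdd _ (hp y)) v

theorem superD_add (hf : SmoothSuperAt I F f x) (hh : SmoothSuperAt I F h x)
    (v : TangentSpace I x) : superD D (f + h) x v = superD D f x v + superD D h x v := by
  rw [superD_eq D (hf.add hh), superD_eq D hf, superD_eq D hh, superCoord_add,
    coordDeriv_add hf hh, map_add, Pi.add_apply, map_add]
  abel

theorem superD_mul (hf : SmoothSuperAt I F f x) (hh : SmoothSuperAt I F h x)
    (v : TangentSpace I x) :
    superD D (f * h) x v = superD D f x v * h x + f x * superD D h x v := by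
  have hx : x ∈ (trivializationAt F S x).baseSet := FiberBundle.mem_baseSet_trivializationAt' x
  have coord_leibniz := coordDeriv_bilin (finBasis 𝕜 F).ExteriorAlgebra
    (LinearMap.mul 𝕜 (ExteriorAlgebra 𝕜 F)) hf hh v
  simp only [LinearMap.mul_apply'] at coord_leibniz
  rw [superD_eq D (hf.mul hh), superD_eq D hf, superD_eq D hh, superCoord_mul,
    coord_leibniz, map_add, map_mul, map_mul, map_symm_superCoord hx, map_symm_superCoord hx,
    Pi.mul_apply, derivOfEnd_mul]
  noncomm_ring

theorem superD_algebraMap {a : M → 𝕜} (ha : ContMDiffAt I 𝓘(ℝ, 𝕜) ∞ a x)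
    (v : TangentSpace I x) :
    superD D (fun y => algebraMap 𝕜 (ExteriorAlgebra 𝕜 (S y)) (a y)) x v
      = algebraMap 𝕜 _ (mvfderiv I a x v) := by
  rw [superD_eq D (SmoothSuperAt.of_scalar ha), superCoord_algebraMap,
    coordDeriv_linear _ _ (coordSmoothAt_singleton ha), coordDeriv_singleton ha,
    derivOfEnd_algebraMap, add_zero, Algebra.linearMap_apply, AlgHom.commutes]

theorem superD_const_smul (c : 𝕜) (hf : SmoothSuperAt I F f x) (v : TangentSpace I x) :
    superD D (c • f) x v = c • superD D f x v := by
  have smul_eq_mul : c • f = (fun y => algebraMap 𝕜 (ExteriorAlgebra 𝕜 (S y)) c) * f :=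
    funext fun y => Algebra.smul_def c (f y)
  rw [smul_eq_mul, superD_mul D (.of_scalar contMDiffAt_const) hf,
    superD_algebraMap D contMDiffAt_const, mvfderiv_const, Algebra.smul_def]
  simp

theorem superD_sum {α : Type*} (s : Finset α) {f : α → Π x, ExteriorAlgebra 𝕜 (S x)}
    (hf : ∀ i ∈ s, SmoothSuperAt I F (f i) x) (v : TangentSpace I x) :
    superD D (fun y => ∑ i ∈ s, f i y) x v = ∑ i ∈ s, superD D (f i) x v := by
  classical
  induction s using Finset.induction_on with
  | empty =>
    have h := superD_algebraMap D (contMDiffAt_const (c := (0 : 𝕜))) v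
    rw [mvfderiv_const] at h
    simpa only [map_zero, Finset.sum_empty, zero_apply] using h
  | insert i s hi ih =>
    have hs := fun j hj => hf j (Finset.mem_insert_of_mem hj)
    simp only [Finset.sum_insert hi]
    rw [← ih hs]
    exact superD_add D (hf i (Finset.mem_insert_self i s)) (SmoothSuperAt.sum hs) v

theorem superD_add_vec (f : Π x, ExteriorAlgebra 𝕜 (S x)) (x : M) (u v : TangentSpace I x) :
    superD D f x (u + v) = superD D f x u + superD D f x v := by
  simp only [superD, map_add, add_smul, Finset.sum_add_distrib, connectionForm_add, derivOfEnd_add,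
    LinearMap.add_apply]
  abel

variable [IsScalarTower ℝ 𝕜 F]

theorem superD_smul_vec (f : Π x, ExteriorAlgebra 𝕜 (S x)) (x : M) (r : ℝ)
    (v : TangentSpace I x) : superD D f x (r • v) = (r : 𝕜) • superD D f x v := by
  simp only [superD, map_smul, RCLike.real_smul_eq_coe_smul (K := 𝕜), smul_assoc,
    connectionForm_smul, derivOfEnd_smul, LinearMap.smul_apply, smul_add, Finset.smul_sum]

theorem superD_sum_vec (f : Π x, ExteriorAlgebra 𝕜 (S x)) (x : M) {α : Type*} (s : Finset α)
    (r : α → ℝ) (v : α → TangentSpace I x) :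
    superD D f x (∑ i ∈ s, r i • v i) = ∑ i ∈ s, (r i : 𝕜) • superD D f x (v i) := by
  classical
  induction s using Finset.induction_on with
  | empty => simpa using superD_smul_vec D f x 0 0
  | insert i s hi ih => rw [Finset.sum_insert hi, Finset.sum_insert hi, superD_add_vec,
      superD_smul_vec, ih]

end Derivative

variable [IsScalarTower ℝ 𝕜 F]

theorem coordSmoothAt_superCoord_ι {σ : Π x : M, S x} {x₀ y : M}
    (hy : y ∈ (trivializationAt F S x₀).baseSet)
    (hσ : ContMDiffAt I (I.prod 𝓘(ℝ, F)) ∞ (fun z ↦ TotalSpace.mk' F z (σ z)) y) :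
    CoordSmoothAt I (finBasis 𝕜 F).ExteriorAlgebra
      (superCoord F x₀ (fun y => ExteriorAlgebra.ι 𝕜 (σ y))) y := by
  rw [superCoord_ι]
  exact ((coordSmoothAt_section_iff (b := finBasis 𝕜 F) hy).2 hσ).linear _ (ExteriorAlgebra.ι 𝕜)

theorem SmoothSuperAt.of_section {x : M} {σ : Π x : M, S x}
    (hσ : ContMDiffAt I (I.prod 𝓘(ℝ, F)) ∞ (fun z ↦ TotalSpace.mk' F z (σ z)) x) :
    SmoothSuperAt I F (fun y => ExteriorAlgebra.ι 𝕜 (σ y)) x :=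
  coordSmoothAt_superCoord_ι (FiberBundle.mem_baseSet_trivializationAt' x) hσ

theorem coordSmoothAt_superCoord_map_symm {x₀ x₁ y : M}
    (h₀ : y ∈ (trivializationAt F S x₀).baseSet) (h₁ : y ∈ (trivializationAt F S x₁).baseSet)
    (a : ExteriorAlgebra 𝕜 F) :
    CoordSmoothAt I (finBasis 𝕜 F).ExteriorAlgebra
      (superCoord F x₀ (fun z => ExteriorAlgebra.map ((trivializationAt F S x₁).symmₗ 𝕜 z) a))
      y := by
  induction a using ExteriorAlgebra.induction with
  | algebraMap r =>
    simp only [AlgHom.commutes]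
    exact coordSmoothAt_superCoord_algebraMap x₀ contMDiffAt_const
  | ι w =>
    simp only [ExteriorAlgebra.map_apply_ι]
    exact coordSmoothAt_superCoord_ι h₀ (contMDiffAt_symmₗ_section x₁ h₁ w)
  | mul a b ha hb =>
    simp only [map_mul]
    exact coordSmoothAt_superCoord_mul ha hb
  | add a b ha hb =>
    simp only [map_add]
    have h := CoordSmoothAt.add ha hb
    rw [← superCoord_add] at h
    exact h

theorem coordSmoothAt_superCoord_change {x₀ x₁ y : M}
    (h₀ : y ∈ (trivializationAt F S x₀).baseSet) (h₁ : y ∈ (trivializationAt F S x₁).baseSet)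
    {f : Π x, ExteriorAlgebra 𝕜 (S x)}
    (hf : CoordSmoothAt I (finBasis 𝕜 F).ExteriorAlgebra (superCoord F x₁ f) y) :
    CoordSmoothAt I (finBasis 𝕜 F).ExteriorAlgebra (superCoord F x₀ f) y := by
  have eq_sum := Filter.mem_of_superset
    ((trivializationAt F S x₁).open_baseSet.mem_nhds h₁) fun z hz => map_symm_eq_sum x₁ hz f
  refine CoordSmoothAt.congr ?_ (superCoord_congr eq_sum)
  rw [superCoord_sum]
  exact CoordSmoothAt.sum fun A _ => coordSmoothAt_superCoord_mul
    (coordSmoothAt_superCoord_algebraMap x₀ (coordSmoothAt_iff_repr.1 hf A))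
    (coordSmoothAt_superCoord_map_symm h₀ h₁ _)

theorem superD_ι [∀ x, IsTopologicalAddGroup (S x)] [∀ x, ContinuousSMul ℝ (S x)]
    [IsManifold I ∞ M] (D : SpinorConnection 𝕜 I F S) {x : M} {σ : Π x : M, S x}
    (hσ : ContMDiffAt I (I.prod 𝓘(ℝ, F)) ∞ (fun z ↦ TotalSpace.mk' F z (σ z)) x)
    (v : TangentSpace I x) :
    superD D (fun y => ExteriorAlgebra.ι 𝕜 (σ y)) x v
      = ExteriorAlgebra.ι 𝕜 (D.toFun σ x v) := by
  have hx : x ∈ (trivializationAt F S x).baseSet := FiberBundle.mem_baseSet_trivializationAt' x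
  rw [superD_eq D (SmoothSuperAt.of_section hσ), superCoord_ι,
    coordDeriv_linear _ _ ((coordSmoothAt_section_iff (b := finBasis 𝕜 F) hx).2 hσ), derivOfEnd_ι,
    ExteriorAlgebra.map_apply_ι, ← map_add,
    D.apply_eq_coordDeriv_add_connectionForm (finBasis 𝕜 F) hσ]

end Superfunctions

section LieBracket

open VectorField

variable {𝕜 : Type*} [RCLike 𝕜]
  {E : Type*} [NormedAddCommGroup E] [NormedSpace ℝ E]
  {H : Type*} [TopologicalSpace H] {I : ModelWithCorners ℝ E H}
  {M : Type*} [TopologicalSpace M] [ChartedSpace H M] [IsManifold I ∞ M]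

theorem contMDiffAt_mvfderiv_apply {a : M → 𝕜} {Y : Π y : M, TangentSpace I y} {x : M}
    (ha : ContMDiffAt I 𝓘(ℝ, 𝕜) ∞ a x)
    (hY : ContMDiffAt I (I.prod 𝓘(ℝ, E)) ∞ (fun y ↦ TotalSpace.mk' E y (Y y)) x) :
    ContMDiffAt I 𝓘(ℝ, 𝕜) ∞ (fun y => mvfderiv I a y (Y y)) x := by
  have hda := ContMDiffAt.mfderiv_const (m := ∞) ha (by simp)
  have hdaY := ContMDiffAt.clm_apply_of_inCoordinates (b₁ := id) (b₂ := a)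
    (E₁ := (TangentSpace I : M → Type _)) (E₂ := (TangentSpace 𝓘(ℝ, 𝕜) : 𝕜 → Type _))
    (ϕ := fun y => mfderiv I 𝓘(ℝ, 𝕜) a y) (v := Y) hda hY ha
  rw [contMDiffAt_totalSpace] at hdaY
  simpa [TangentBundle.trivializationAt_apply] using! hdaY.2

theorem eventually_mdifferentiableAt {a : M → 𝕜} {x : M} (ha : ContMDiffAt I 𝓘(ℝ, 𝕜) ∞ a x) :
    ∀ᶠ y in 𝓝 x, MDifferentiableAt I 𝓘(ℝ, 𝕜) a y := by
  have : IsManifold I 1 M := IsManifold.of_le (n := ∞) (by simp)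
  exact ((contMDiffAt_iff_contMDiffAt_nhds (n := 1) (by simp)).1 (ha.of_le (by simp))).mono
    fun y hy => hy.mdifferentiableAt one_ne_zero

theorem eventually_mdifferentiableAt_field {Y : Π y : M, TangentSpace I y} {x : M}
    (hY : ContMDiffAt I (I.prod 𝓘(ℝ, E)) ∞ (fun y ↦ TotalSpace.mk' E y (Y y)) x) :
    ∀ᶠ y in 𝓝 x, MDifferentiableAt I (I.prod 𝓘(ℝ, E)) (fun y ↦ TotalSpace.mk' E y (Y y)) y := by
  have : IsManifold I 1 M := IsManifold.of_le (n := ∞) (by simp)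
  have : IsManifold I (1 + 1) M := IsManifold.of_le (n := ∞)
    (by rw [one_add_one_eq_two]; exact ENat.LEInfty.out)
  exact ((contMDiffAt_iff_contMDiffAt_nhds (n := 1) (by simp)).1 (hY.of_le (by simp))).mono
    fun y hy => hy.mdifferentiableAt one_ne_zero

section Real

theorem minSmoothness_real_le (n : WithTop ℕ∞) [ENat.LEInfty n] : minSmoothness ℝ n ≤ ∞ := by
  rw [minSmoothness_of_isRCLikeNormedField]
  exact ENat.LEInfty.out

variable {a : M → ℝ} {X Y W : Π y : M, TangentSpace I y} {x : M}

theorem mlieBracket_mlieBracket_smul [CompleteSpace E] (ha : ContMDiffAt I 𝓘(ℝ, ℝ) ∞ a x)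
    (hY : ContMDiffAt I (I.prod 𝓘(ℝ, E)) ∞ (fun y ↦ TotalSpace.mk' E y (Y y)) x)
    (hW : ContMDiffAt I (I.prod 𝓘(ℝ, E)) ∞ (fun y ↦ TotalSpace.mk' E y (W y)) x) :
    mlieBracket I X (mlieBracket I Y (a • W)) x
      = mvfderiv I (fun y => mvfderiv I a y (Y y)) x (X x) • W x
        + mvfderiv I a x (Y x) • mlieBracket I X W x
        + (mvfderiv I a x (X x) • mlieBracket I Y W x
          + a x • mlieBracket I X (mlieBracket I Y W) x) := by
  have : IsManifold I (minSmoothness ℝ 3) M :=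
    IsManifold.of_le (minSmoothness_real_le _)
  have : IsManifold I (minSmoothness ℝ 2) M :=
    IsManifold.of_le (minSmoothness_real_le _)
  have : IsManifold I (∞ + 1) M := IsManifold.of_le (n := ∞) (by simp)
  have hYaW : mlieBracket I Y (a • W) =ᶠ[𝓝 x]
      (fun y => mvfderiv I a y (Y y)) • W + a • mlieBracket I Y W := by
    filter_upwards [eventually_mdifferentiableAt ha, eventually_mdifferentiableAt_field hW]
      with y hay hWy
    exact mlieBracket_smul_right hay hWy
  have dYa := (contMDiffAt_mvfderiv_apply ha hY).mdifferentiableAt (n := ∞) (by simp)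
  have dYW : MDifferentiableAt I (I.prod 𝓘(ℝ, E))
      (fun y ↦ TotalSpace.mk' E y (mlieBracket I Y W y)) x :=
    (ContMDiffAt.mlieBracket_vectorField (n := ⊤) (m := ⊤) hY hW (by simp)).mdifferentiableAt
      (by simp)
  have dW := hW.mdifferentiableAt (n := ∞) (by simp)
  have da := ha.mdifferentiableAt (n := ∞) (by simp)
  rw [(Filter.EventuallyEq.refl _ X).mlieBracket_vectorField_eq hYaW,
    mlieBracket_add_right (dYa.smul_section dW) (da.smul_section dYW),
    mlieBracket_smul_right dYa dW, mlieBracket_smul_right da dYW]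

-- This is the difference of the Jacobi identities for `X`, `Y`, `a • W` and for `X`, `Y`, `W`.
theorem mvfderiv_mlieBracket_sub_smul [CompleteSpace E] (ha : ContMDiffAt I 𝓘(ℝ, ℝ) ∞ a x)
    (hX : ContMDiffAt I (I.prod 𝓘(ℝ, E)) ∞ (fun y ↦ TotalSpace.mk' E y (X y)) x)
    (hY : ContMDiffAt I (I.prod 𝓘(ℝ, E)) ∞ (fun y ↦ TotalSpace.mk' E y (Y y)) x)
    (hW : ContMDiffAt I (I.prod 𝓘(ℝ, E)) ∞ (fun y ↦ TotalSpace.mk' E y (W y)) x) :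
    (mvfderiv I a x (mlieBracket I X Y x)
      - (mvfderiv I (fun y => mvfderiv I a y (Y y)) x (X x)
        - mvfderiv I (fun y => mvfderiv I a y (X y)) x (Y x))) • W x = 0 := by
  have : IsManifold I (minSmoothness ℝ 3) M :=
    IsManifold.of_le (minSmoothness_real_le _)
  have hmin : minSmoothness ℝ 2 ≤ ∞ := minSmoothness_real_le 2
  have jacobi_W := leibniz_identity_mlieBracket_apply (I := I) (U := X) (V := Y) (W := W)
    (hX.of_le hmin) (hY.of_le hmin) (hW.of_le hmin)
  have jacobi_aW := leibniz_identity_mlieBracket_apply (I := I) (U := X) (V := Y) (W := a • W)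
    (hX.of_le hmin) (hY.of_le hmin) ((ha.smul_section hW).of_le hmin)
  rw [mlieBracket_mlieBracket_smul ha hY hW, mlieBracket_mlieBracket_smul ha hX hW,
    mlieBracket_smul_right (ha.mdifferentiableAt (n := ∞) (by simp))
      (hW.mdifferentiableAt (n := ∞) (by simp)), jacobi_W, ← sub_eq_zero] at jacobi_aW
  rw [← neg_eq_zero, ← jacobi_aW]
  module

theorem mvfderiv_mlieBracket_real [FiniteDimensional ℝ E] (ha : ContMDiffAt I 𝓘(ℝ, ℝ) ∞ a x)
    (hX : ContMDiffAt I (I.prod 𝓘(ℝ, E)) ∞ (fun y ↦ TotalSpace.mk' E y (X y)) x)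
    (hY : ContMDiffAt I (I.prod 𝓘(ℝ, E)) ∞ (fun y ↦ TotalSpace.mk' E y (Y y)) x) :
    mvfderiv I a x (mlieBracket I X Y x)
      = mvfderiv I (fun y => mvfderiv I a y (Y y)) x (X x)
        - mvfderiv I (fun y => mvfderiv I a y (X y)) x (Y x) := by
  have : CompleteSpace E := FiniteDimensional.complete ℝ E
  by_cases hnontrivial : ∃ w : TangentSpace I x, w ≠ 0
  · obtain ⟨w, hw⟩ := hnontrivial
    obtain ⟨U, hU, hxU, hW⟩ := exists_contMDiffOn_localExt (I := I) ℝ E w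
    have h := mvfderiv_mlieBracket_sub_smul ha hX hY (hW.contMDiffAt (hU.mem_nhds hxU))
    rw [localExt_self] at h
    exact sub_eq_zero.1 ((smul_eq_zero.1 h).resolve_right hw)
  · push Not at hnontrivial
    rw [hnontrivial (mlieBracket I X Y x), hnontrivial (X x), hnontrivial (Y x)]
    simp only [map_zero, sub_self]

end Real

variable {a : M → 𝕜} {X Y : Π y : M, TangentSpace I y} {x : M}

theorem mvfderiv_mvfderiv_clm_comp (L : 𝕜 →L[ℝ] ℝ) (ha : ContMDiffAt I 𝓘(ℝ, 𝕜) ∞ a x)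
    (hY : ContMDiffAt I (I.prod 𝓘(ℝ, E)) ∞ (fun y ↦ TotalSpace.mk' E y (Y y)) x)
    (v : TangentSpace I x) :
    mvfderiv I (fun y => mvfderiv I (fun z => L (a z)) y (Y y)) x v
      = L (mvfderiv I (fun y => mvfderiv I a y (Y y)) x v) := by
  have dYa := (contMDiffAt_mvfderiv_apply ha hY).mdifferentiableAt (n := ∞) (by simp)
  have hLa : (fun y => mvfderiv I (fun z => L (a z)) y (Y y))
      =ᶠ[𝓝 x] fun y => L (mvfderiv I a y (Y y)) :=
    (eventually_mdifferentiableAt ha).mono fun y hy => mvfderiv_clm_comp L hy _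
  rw [mvfderiv_congr hLa, mvfderiv_clm_comp L dYa]

theorem mvfderiv_mlieBracket [FiniteDimensional ℝ E] (ha : ContMDiffAt I 𝓘(ℝ, 𝕜) ∞ a x)
    (hX : ContMDiffAt I (I.prod 𝓘(ℝ, E)) ∞ (fun y ↦ TotalSpace.mk' E y (X y)) x)
    (hY : ContMDiffAt I (I.prod 𝓘(ℝ, E)) ∞ (fun y ↦ TotalSpace.mk' E y (Y y)) x) :
    mvfderiv I a x (mlieBracket I X Y x)
      = mvfderiv I (fun y => mvfderiv I a y (Y y)) x (X x)
        - mvfderiv I (fun y => mvfderiv I a y (X y)) x (Y x) := by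
  have real_part : ∀ L : 𝕜 →L[ℝ] ℝ, L (mvfderiv I a x (mlieBracket I X Y x))
      = L (mvfderiv I (fun y => mvfderiv I a y (Y y)) x (X x)
        - mvfderiv I (fun y => mvfderiv I a y (X y)) x (Y x)) := fun L => by
    have h := mvfderiv_mlieBracket_real (a := fun y => L (a y))
      (L.contDiff.contMDiff.contMDiffAt.comp x ha) hX hY
    rwa [mvfderiv_clm_comp L (ha.mdifferentiableAt (by simp)),
      mvfderiv_mvfderiv_clm_comp L ha hY, mvfderiv_mvfderiv_clm_comp L ha hX, ← map_sub] at h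
  exact RCLike.ext (real_part RCLike.reCLM) (real_part RCLike.imCLM)

end LieBracket

section Generators

variable {𝕜 : Type*} [RCLike 𝕜]
  {E : Type*} [NormedAddCommGroup E] [NormedSpace ℝ E]
  {H : Type*} [TopologicalSpace H] {I : ModelWithCorners ℝ E H}
  {M : Type*} [TopologicalSpace M] [ChartedSpace H M]
  {F : Type*} [NormedAddCommGroup F] [NormedSpace ℝ F] [NormedSpace 𝕜 F]
  {S : M → Type*} [TopologicalSpace (TotalSpace F S)]
  [∀ x, AddCommGroup (S x)] [∀ x, Module 𝕜 (S x)] [∀ x, TopologicalSpace (S x)]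
  [FiberBundle F S] [VectorBundle 𝕜 F S]

variable (I F) in
/-- The algebra generated by the smooth functions on `U` and the sections of `S` which have
constant coefficients in the preferred trivialization at `x`. Identities between derivations need
only be checked on these generators. -/
inductive LocallyGenerated (x : M) (U : Set M) : (Π y, ExteriorAlgebra 𝕜 (S y)) → Prop
  | scalar (a : M → 𝕜) (ha : ContMDiffOn I 𝓘(ℝ, 𝕜) ∞ a U) :
      LocallyGenerated x U (fun y => algebraMap 𝕜 (ExteriorAlgebra 𝕜 (S y)) (a y))
  | vec (s : S x)
      (hs : ContMDiffOn I (I.prod 𝓘(ℝ, F)) ∞ (fun y ↦ TotalSpace.mk' F y (localExt 𝕜 F s y)) U) :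
      LocallyGenerated x U (fun y => ExteriorAlgebra.ι 𝕜 (localExt 𝕜 F s y))
  | add (f h : Π y, ExteriorAlgebra 𝕜 (S y)) (hf : LocallyGenerated x U f)
      (hh : LocallyGenerated x U h) : LocallyGenerated x U (f + h)
  | mul (f h : Π y, ExteriorAlgebra 𝕜 (S y)) (hf : LocallyGenerated x U f)
      (hh : LocallyGenerated x U h) : LocallyGenerated x U (f * h)

theorem LocallyGenerated.sum {x : M} {U : Set M} {α : Type*} (s : Finset α)
    {f : α → Π y, ExteriorAlgebra 𝕜 (S y)}
    (hf : ∀ i ∈ s, LocallyGenerated I F x U (f i)) :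
    LocallyGenerated I F x U (fun y => ∑ i ∈ s, f i y) := by
  classical
  induction s using Finset.induction_on with
  | empty =>
    have h := LocallyGenerated.scalar (I := I) (F := F) (S := S) (x := x) (U := U)
      (fun _ => (0 : 𝕜)) contMDiffOn_const
    simpa only [map_zero, Finset.sum_empty] using h
  | insert i s hi ih =>
    simp only [Finset.sum_insert hi]
    exact (hf i (Finset.mem_insert_self i s)).add _ _
      (ih fun j hj => hf j (Finset.mem_insert_of_mem hj))

variable [∀ x, Module ℝ (S x)] [VectorBundle ℝ F S] [ContMDiffVectorBundle ∞ F S I]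

theorem LocallyGenerated.map_symm {x : M} {U : Set M}
    (hU : U ⊆ (trivializationAt F S x).baseSet) (a : ExteriorAlgebra 𝕜 F) :
    LocallyGenerated I F x U
      (fun y => ExteriorAlgebra.map ((trivializationAt F S x).symmₗ 𝕜 y) a) := by
  induction a using ExteriorAlgebra.induction with
  | algebraMap r =>
    simp only [AlgHom.commutes]
    exact .scalar (fun _ => r) contMDiffOn_const
  | ι w =>
    have hw : (fun y => ExteriorAlgebra.map ((trivializationAt F S x).symmₗ 𝕜 y)
        (ExteriorAlgebra.ι 𝕜 w)) = fun y => ExteriorAlgebra.ι 𝕜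
          (localExt 𝕜 F ((trivializationAt F S x).symmₗ 𝕜 x w) y) := funext fun y => by
      rw [ExteriorAlgebra.map_apply_ι, localExt_symmₗ]
    rw [hw]
    refine .vec _ fun y hy => ?_
    simp only [localExt_symmₗ]
    exact (contMDiffAt_symmₗ_section x (hU hy) w).contMDiffWithinAt
  | mul a b ha hb =>
    simp only [map_mul]
    exact ha.mul _ _ hb
  | add a b ha hb =>
    simp only [map_add]
    exact ha.add _ _ hb

variable [FiniteDimensional 𝕜 F]

section SecondDerivatives

variable [∀ x, IsTopologicalAddGroup (S x)] [∀ x, ContinuousSMul ℝ (S x)] [IsManifold I ∞ M]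
  (D : SpinorConnection 𝕜 I F S) {f h : Π y, ExteriorAlgebra 𝕜 (S y)} {x : M}
  {Y : Π y : M, TangentSpace I y}

theorem superD_superD_algebraMap {a : M → 𝕜} {U : Set M} (hU : IsOpen U) (hx : x ∈ U)
    (ha : ContMDiffOn I 𝓘(ℝ, 𝕜) ∞ a U)
    (hY : ContMDiffOn I (I.prod 𝓘(ℝ, E)) ∞ (fun y ↦ TotalSpace.mk' E y (Y y)) U)
    (v : TangentSpace I x) :
    superD D (fun y => superD D (fun z => algebraMap 𝕜 (ExteriorAlgebra 𝕜 (S z)) (a z)) y (Y y)) x v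
      = algebraMap 𝕜 _ (mvfderiv I (fun y => mvfderiv I a y (Y y)) x v) := by
  have hUx := hU.mem_nhds hx
  rw [← superD_algebraMap D (contMDiffAt_mvfderiv_apply (ha.contMDiffAt hUx) (hY.contMDiffAt hUx))]
  refine superD_congr D ?_ _
  filter_upwards [hUx] with z hz
  exact superD_algebraMap D (ha.contMDiffAt (hU.mem_nhds hz)) _

theorem superD_superD_add (hf : ∀ᶠ y in 𝓝 x, SmoothSuperAt I F f y)
    (hh : ∀ᶠ y in 𝓝 x, SmoothSuperAt I F h y)
    (hDf : SmoothSuperAt I F (fun y => superD D f y (Y y)) x)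
    (hDh : SmoothSuperAt I F (fun y => superD D h y (Y y)) x) (v : TangentSpace I x) :
    superD D (fun y => superD D (f + h) y (Y y)) x v
      = superD D (fun y => superD D f y (Y y)) x v
        + superD D (fun y => superD D h y (Y y)) x v := by
  rw [← superD_add D hDf hDh]
  refine superD_congr D ?_ _
  filter_upwards [hf, hh] with z hfz hhz
  exact superD_add D hfz hhz _

theorem superD_superD_mul (hf : ∀ᶠ y in 𝓝 x, SmoothSuperAt I F f y)
    (hh : ∀ᶠ y in 𝓝 x, SmoothSuperAt I F h y)
    (hDf : SmoothSuperAt I F (fun y => superD D f y (Y y)) x)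
    (hDh : SmoothSuperAt I F (fun y => superD D h y (Y y)) x) (v : TangentSpace I x) :
    superD D (fun y => superD D (f * h) y (Y y)) x v
      = superD D (fun y => superD D f y (Y y)) x v * h x + superD D f x (Y x) * superD D h x v
        + (superD D f x v * superD D h x (Y x)
          + f x * superD D (fun y => superD D h y (Y y)) x v) := by
  have hDfh : ∀ᶠ y in 𝓝 x, superD D (f * h) y (Y y)
      = ((fun y => superD D f y (Y y)) * h + f * (fun y => superD D h y (Y y))) y := by
    filter_upwards [hf, hh] with z hfz hhz
    exact superD_mul D hfz hhz _
  have hfx := hf.self_of_nhds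
  have hhx := hh.self_of_nhds
  rw [superD_congr D hDfh, superD_add D (hDf.mul hhx) (hfx.mul hDh), superD_mul D hDf hhx,
    superD_mul D hfx hDh]

end SecondDerivatives

variable [IsScalarTower ℝ 𝕜 F]

namespace LocallyGenerated

variable {x : M} {U : Set M} {f : Π y, ExteriorAlgebra 𝕜 (S y)}

theorem smoothSuperAt (hf : LocallyGenerated I F x U f) (hU : IsOpen U) {y : M} (hy : y ∈ U) :
    SmoothSuperAt I F f y := by
  induction hf with
  | scalar a ha => exact SmoothSuperAt.of_scalar (ha.contMDiffAt (hU.mem_nhds hy))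
  | vec s hs => exact SmoothSuperAt.of_section (hs.contMDiffAt (hU.mem_nhds hy))
  | add f h _ _ hf hh => exact hf.add hh
  | mul f h _ _ hf hh => exact hf.mul hh

theorem exists_eqOn {V : Set M} (hV : IsOpen V) (hx : x ∈ V)
    (hf : ∀ y ∈ V, SmoothSuperAt I F f y) :
    ∃ (U : Set M) (h : Π y, ExteriorAlgebra 𝕜 (S y)), IsOpen U ∧ x ∈ U ∧ U ⊆ V ∧
      LocallyGenerated I F x U h ∧ ∀ y ∈ U, f y = h y := by
  have hxb : x ∈ (trivializationAt F S x).baseSet := FiberBundle.mem_baseSet_trivializationAt' x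
  refine ⟨V ∩ (trivializationAt F S x).baseSet, _, hV.inter (trivializationAt F S x).open_baseSet,
    ⟨hx, hxb⟩, Set.inter_subset_left, ?_, fun y hy => map_symm_eq_sum x hy.2 f⟩
  refine sum _ fun A _ => mul _ _ (scalar _ fun y hy => ?_) (map_symm Set.inter_subset_right _)
  exact (coordSmoothAt_iff_repr.1 (coordSmoothAt_superCoord_change hy.2
    (FiberBundle.mem_baseSet_trivializationAt' y) (hf y hy.1)) A).contMDiffWithinAt

variable [∀ x, IsTopologicalAddGroup (S x)] [∀ x, ContinuousSMul ℝ (S x)] [IsManifold I ∞ M]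
  (D : SpinorConnection 𝕜 I F S)

theorem smoothSuperAt_superD (hf : LocallyGenerated I F x U f) (hU : IsOpen U)
    {Y : Π y : M, TangentSpace I y}
    (hY : ContMDiffOn I (I.prod 𝓘(ℝ, E)) ∞ (fun y ↦ TotalSpace.mk' E y (Y y)) U)
    {y : M} (hy : y ∈ U) : SmoothSuperAt I F (fun z => superD D f z (Y z)) y := by
  have hUy := hU.mem_nhds hy
  induction hf with
  | scalar a ha =>
    refine (SmoothSuperAt.of_scalar (contMDiffAt_mvfderiv_apply (ha.contMDiffAt hUy)
      (hY.contMDiffAt hUy))).congr ?_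
    filter_upwards [hUy] with z hz
    exact superD_algebraMap D (ha.contMDiffAt (hU.mem_nhds hz)) _
  | vec s hs =>
    refine (SmoothSuperAt.of_section ((D.contMDiffOn_apply hU hs hY).contMDiffAt hUy)).congr ?_
    filter_upwards [hUy] with z hz
    exact superD_ι D (hs.contMDiffAt (hU.mem_nhds hz)) _
  | add f h hf hh ihf ihh =>
    refine (ihf.add ihh).congr ?_
    filter_upwards [hUy] with z hz
    exact superD_add D (hf.smoothSuperAt hU hz) (hh.smoothSuperAt hU hz) _
  | mul f h hf hh ihf ihh =>
    refine ((ihf.mul (hh.smoothSuperAt hU hy)).add ((hf.smoothSuperAt hU hy).mul ihh)).congr ?_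
    filter_upwards [hUy] with z hz
    exact superD_mul D (hf.smoothSuperAt hU hz) (hh.smoothSuperAt hU hz) _

end LocallyGenerated

section Commutator

variable [∀ x, IsTopologicalAddGroup (S x)] [∀ x, ContinuousSMul ℝ (S x)] [IsManifold I ∞ M]
  (D : SpinorConnection 𝕜 I F S) {f : Π y, ExteriorAlgebra 𝕜 (S y)} {U : Set M} {x : M}

theorem superD_superD_ι {σ : Π y, S y} {Y : Π y : M, TangentSpace I y}
    (hU : IsOpen U) (hx : x ∈ U)
    (hσ : ContMDiffOn I (I.prod 𝓘(ℝ, F)) ∞ (fun y ↦ TotalSpace.mk' F y (σ y)) U)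
    (hY : ContMDiffOn I (I.prod 𝓘(ℝ, E)) ∞ (fun y ↦ TotalSpace.mk' E y (Y y)) U)
    (v : TangentSpace I x) :
    superD D (fun y => superD D (fun z => ExteriorAlgebra.ι 𝕜 (σ z)) y (Y y)) x v
      = ExteriorAlgebra.ι 𝕜 (D.toFun (fun y => D.toFun σ y (Y y)) x v) := by
  have hUx := hU.mem_nhds hx
  rw [← superD_ι D ((D.contMDiffOn_apply hU hσ hY).contMDiffAt hUx)]
  refine superD_congr D ?_ _
  filter_upwards [hUx] with z hz
  exact superD_ι D (hσ.contMDiffAt (hU.mem_nhds hz)) _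

variable [FiniteDimensional ℝ E]

theorem LocallyGenerated.superD_commutator (hf : LocallyGenerated I F x U f) (hU : IsOpen U)
    (hx : x ∈ U) (u v : TangentSpace I x)
    (hu : ContMDiffOn I (I.prod 𝓘(ℝ, E)) ∞ (fun y ↦ TotalSpace.mk' E y (localExt ℝ E u y)) U)
    (hv : ContMDiffOn I (I.prod 𝓘(ℝ, E)) ∞ (fun y ↦ TotalSpace.mk' E y (localExt ℝ E v y)) U) :
    superD D (fun y => superD D f y (localExt ℝ E v y)) x u
      - superD D (fun y => superD D f y (localExt ℝ E u y)) x v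
      = superD D f x (VectorField.mlieBracket I (localExt ℝ E u) (localExt ℝ E v) x)
        + derivOfEnd (curvature D x u v) (f x) := by
  have hUx := hU.mem_nhds hx
  have smooth {k : Π y, ExteriorAlgebra 𝕜 (S y)} (hk : LocallyGenerated I F x U k) :
      ∀ᶠ y in 𝓝 x, SmoothSuperAt I F k y :=
    Filter.mem_of_superset hUx fun y hy => hk.smoothSuperAt hU hy
  induction hf with
  | scalar a ha =>
    rw [superD_superD_algebraMap D hU hx ha hv, superD_superD_algebraMap D hU hx ha hu,
      superD_algebraMap D (ha.contMDiffAt hUx), derivOfEnd_algebraMap, add_zero,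
      mvfderiv_mlieBracket (ha.contMDiffAt hUx) (hu.contMDiffAt hUx) (hv.contMDiffAt hUx), map_sub,
      localExt_self, localExt_self]
  | vec s hs =>
    rw [superD_superD_ι D hU hx hs hv, superD_superD_ι D hU hx hs hu,
      superD_ι D (hs.contMDiffAt hUx), derivOfEnd_ι, localExt_self, ← map_sub, ← map_add]
    exact congrArg _ (add_sub_cancel _ _).symm
  | add f h hf hh ihf ihh =>
    rw [superD_superD_add D (smooth hf) (smooth hh) (hf.smoothSuperAt_superD D hU hv hx)
        (hh.smoothSuperAt_superD D hU hv hx),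
      superD_superD_add D (smooth hf) (smooth hh) (hf.smoothSuperAt_superD D hU hu hx)
        (hh.smoothSuperAt_superD D hU hu hx),
      superD_add D (hf.smoothSuperAt hU hx) (hh.smoothSuperAt hU hx), Pi.add_apply, map_add,
      add_sub_add_comm, ihf, ihh, add_add_add_comm]
  | mul f h hf hh ihf ihh =>
    rw [superD_superD_mul D (smooth hf) (smooth hh) (hf.smoothSuperAt_superD D hU hv hx)
        (hh.smoothSuperAt_superD D hU hv hx),
      superD_superD_mul D (smooth hf) (smooth hh) (hf.smoothSuperAt_superD D hU hu hx)
        (hh.smoothSuperAt_superD D hU hu hx),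
      superD_mul D (hf.smoothSuperAt hU hx) (hh.smoothSuperAt hU hx), Pi.mul_apply,
      derivOfEnd_mul, localExt_self, localExt_self, eq_add_of_sub_eq ihf, eq_add_of_sub_eq ihh]
    noncomm_ring

theorem superD_commutator (hU : IsOpen U)
    (hf : ∀ y ∈ U, SmoothSuperAt I F f y) (hx : x ∈ U) (u v : TangentSpace I x)
    (hu : ContMDiffOn I (I.prod 𝓘(ℝ, E)) ∞ (fun y ↦ TotalSpace.mk' E y (localExt ℝ E u y)) U)
    (hv : ContMDiffOn I (I.prod 𝓘(ℝ, E)) ∞ (fun y ↦ TotalSpace.mk' E y (localExt ℝ E v y)) U) :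
    superD D (fun y => superD D f y (localExt ℝ E v y)) x u
      - superD D (fun y => superD D f y (localExt ℝ E u y)) x v
      = superD D f x (VectorField.mlieBracket I (localExt ℝ E u) (localExt ℝ E v) x)
        + derivOfEnd (curvature D x u v) (f x) := by
  obtain ⟨V, h, hV, hxV, hVU, hh, hfh⟩ := LocallyGenerated.exists_eqOn hU hx hf
  have eventually_eq (y) (hy : y ∈ V) : ∀ᶠ z in 𝓝 y, f z = h z :=
    Filter.mem_of_superset (hV.mem_nhds hy) hfh
  have superD_superD_eq (w w' : TangentSpace I x) :
      superD D (fun y => superD D f y (localExt ℝ E w y)) x w'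
        = superD D (fun y => superD D h y (localExt ℝ E w y)) x w' :=
    superD_congr D (Filter.mem_of_superset (hV.mem_nhds hxV) fun y hy =>
      superD_congr D (eventually_eq y hy) _) _
  rw [superD_superD_eq, superD_superD_eq, superD_congr D (eventually_eq x hxV), hfh x hxV]
  exact hh.superD_commutator D hV hxV u v (hu.mono hVU) (hv.mono hVU)

end Commutator

section SmoothDerivative

variable [∀ x, IsTopologicalAddGroup (S x)] [∀ x, ContinuousSMul ℝ (S x)] [IsManifold I ∞ M]
  (D : SpinorConnection 𝕜 I F S) {f : Π y, ExteriorAlgebra 𝕜 (S y)} {U : Set M}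

theorem smoothSuperAt_superD (hU : IsOpen U) (hf : ∀ y ∈ U, SmoothSuperAt I F f y)
    {Y : Π y : M, TangentSpace I y}
    (hY : ContMDiffOn I (I.prod 𝓘(ℝ, E)) ∞ (fun y ↦ TotalSpace.mk' E y (Y y)) U)
    {y : M} (hy : y ∈ U) : SmoothSuperAt I F (fun z => superD D f z (Y z)) y := by
  obtain ⟨V, h, hV, hyV, hVU, hh, hfh⟩ := LocallyGenerated.exists_eqOn hU hy hf
  refine (hh.smoothSuperAt_superD D hV (hY.mono hVU) hyV).congr ?_
  filter_upwards [hV.mem_nhds hyV] with z hz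
  refine superD_congr D ?_ _
  filter_upwards [hV.mem_nhds hz] with w hw using hfh w hw

end SmoothDerivative

end Generators

section Frames

variable {𝕜 : Type*} [RCLike 𝕜]
  {E : Type*} [NormedAddCommGroup E] [NormedSpace ℝ E]
  {H : Type*} [TopologicalSpace H] {I : ModelWithCorners ℝ E H}
  {M : Type*} [TopologicalSpace M] [ChartedSpace H M]
  {ι : Type*}

section MatrixInverse

variable [Fintype ι] [DecidableEq ι] {n : WithTop ℕ∞} {x : M}

theorem contMDiffAt_det {A : M → Matrix ι ι ℝ}
    (hA : ∀ i j, ContMDiffAt I 𝓘(ℝ, ℝ) n (fun y => A y i j) x) :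
    ContMDiffAt I 𝓘(ℝ, ℝ) n (fun y => (A y).det) x := by
  simp only [Matrix.det_apply']
  exact contMDiffAt_finsetSum fun σ _ =>
    contMDiffAt_const.mul (contMDiffAt_finsetProd fun i _ => hA _ _)

theorem contMDiffAt_matrix_inv {A : M → Matrix ι ι ℝ}
    (hA : ∀ i j, ContMDiffAt I 𝓘(ℝ, ℝ) n (fun y => A y i j) x) (hx : (A x).det ≠ 0) (i j : ι) :
    ContMDiffAt I 𝓘(ℝ, ℝ) n (fun y => (A y)⁻¹ i j) x := by
  simp only [Matrix.inv_def, Ring.inverse_eq_inv', Matrix.smul_apply, smul_eq_mul,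
    Matrix.adjugate_apply]
  have det_inv : ContMDiffAt I 𝓘(ℝ, ℝ) n (fun y => (A y).det⁻¹) x :=
    (contDiffAt_inv ℝ hx).contMDiffAt.comp x (contMDiffAt_det hA)
  refine det_inv.mul (contMDiffAt_det fun k l => ?_)
  simp only [Matrix.updateRow_apply]
  split_ifs
  · exact contMDiffAt_const
  · exact hA k l

end MatrixInverse

variable [IsManifold I ∞ M]

variable (I) in
/-- The basis of `T_y M` with constant coefficients in the preferred trivialization at `x`, if
`y` is in its domain, and `e y` otherwise. -/
def localFrame (e : ∀ x : M, Basis ι ℝ (TangentSpace I x)) (x y : M) :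
    Basis ι ℝ (TangentSpace I y) :=
  open Classical in
  if hy : y ∈ (trivializationAt E (TangentSpace I) x).baseSet then
    ((e x).map ((trivializationAt E (TangentSpace I) x).linearEquivAt ℝ x
      (FiberBundle.mem_baseSet_trivializationAt' x))).map
      ((trivializationAt E (TangentSpace I) x).linearEquivAt ℝ y hy).symm
  else e y

theorem localFrame_apply (e : ∀ x : M, Basis ι ℝ (TangentSpace I x)) {x y : M}
    (hy : y ∈ (trivializationAt E (TangentSpace I) x).baseSet) (μ : ι) :
    localFrame I e x y μ = localExt ℝ E (e x μ) y := by
  rw [localFrame, dif_pos hy, localExt, Trivialization.coe_symmₗ _ hy,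
    Trivialization.coe_linearMapAt_of_mem _ (FiberBundle.mem_baseSet_trivializationAt' x)]
  rfl

theorem localFrame_self (e : ∀ x : M, Basis ι ℝ (TangentSpace I x)) (x : M) :
    localFrame I e x x = e x := by
  ext μ
  rw [localFrame_apply e (FiberBundle.mem_baseSet_trivializationAt' x), localExt_self]

theorem contMDiffOn_localExt [FiniteDimensional ℝ E] (x : M) (v : TangentSpace I x) :
    ContMDiffOn I (I.prod 𝓘(ℝ, E)) ∞ (fun y ↦ TotalSpace.mk' E y (localExt ℝ E v y))
      (trivializationAt E (TangentSpace I : M → Type _) x).baseSet := fun _ hy =>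
  (contMDiffAt_symmₗ_section (𝕜 := ℝ) (S := (TangentSpace I : M → Type _)) x hy
    _).contMDiffWithinAt

theorem eventually_localFrame_eq_localExt (e : ∀ x : M, Basis ι ℝ (TangentSpace I x)) (x : M)
    (μ : ι) : ∀ᶠ y in 𝓝 x, localFrame I e x y μ = localExt ℝ E (e x μ) y := by
  filter_upwards [(trivializationAt E (TangentSpace I : M → Type _) x).open_baseSet.mem_nhds
    (FiberBundle.mem_baseSet_trivializationAt' x)] with y hy using localFrame_apply e hy μ

theorem nabla_localFrame (nabla : CovariantDerivative I E (TangentSpace I : M → Type _))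
    (e : ∀ x : M, Basis ι ℝ (TangentSpace I x)) (x : M) (μ : ι) :
    nabla (fun y => localFrame I e x y μ) x = nabla (localExt ℝ E (e x μ)) x :=
  covariantDerivative_congr nabla (mdifferentiableAt_localExt ℝ E (e x μ))
    (eventually_localFrame_eq_localExt e x μ)

theorem contMDiffAt_localFrame [FiniteDimensional ℝ E]
    (e : ∀ x : M, Basis ι ℝ (TangentSpace I x)) (x : M) (μ : ι) :
    ContMDiffAt I (I.prod 𝓘(ℝ, E)) ∞ (fun y ↦ TotalSpace.mk' E y (localFrame I e x y μ)) x := by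
  refine ((contMDiffOn_localExt x (e x μ)).contMDiffAt
    ((trivializationAt E (TangentSpace I : M → Type _) x).open_baseSet.mem_nhds
      (FiberBundle.mem_baseSet_trivializationAt' x))).congr_of_eventuallyEq ?_
  filter_upwards [eventually_localFrame_eq_localExt e x μ] with y hy
  rw [hy]

variable [Fintype ι]

namespace PseudoRiemannianMetric

variable (g : PseudoRiemannianMetric I M) {x : M}

theorem contraction_eq_of_dual {Λ : Type*} [Ring Λ] [Algebra 𝕜 Λ]
    {e e_dual e' e'_dual : ι → TangentSpace I x}
    (he : ∀ w, ∑ μ, g.val x w (e μ) • e_dual μ = w)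
    (he' : ∀ w, ∑ μ, g.val x (e'_dual μ) w • e' μ = w) (p A : TangentSpace I x → Λ)
    (hp : ∀ (r : ι → ℝ) (v : ι → TangentSpace I x),
      p (∑ i, r i • v i) = ∑ i, (r i : 𝕜) • p (v i))
    (hA : ∀ (r : ι → ℝ) (v : ι → TangentSpace I x),
      A (∑ i, r i • v i) = ∑ i, (r i : 𝕜) • A (v i)) :
    ∑ μ, p (e_dual μ) * A (e μ) = ∑ μ, p (e'_dual μ) * A (e' μ) := by
  have expand_A : ∀ μ, A (e μ) = ∑ ν, (g.val x (e'_dual ν) (e μ) : 𝕜) • A (e' ν) :=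
    fun μ => by rw [← hA, he']
  have expand_p : ∀ ν, p (e'_dual ν) = ∑ μ, (g.val x (e'_dual ν) (e μ) : 𝕜) • p (e_dual μ) :=
    fun ν => by rw [← hp, he]
  simp only [expand_A, expand_p, Finset.mul_sum, Finset.sum_mul, mul_smul_comm, smul_mul_assoc]
  exact Finset.sum_comm

variable [DecidableEq ι] (e : Basis ι ℝ (TangentSpace I x))

theorem sum_raise_smul (w : TangentSpace I x) : ∑ ν, g.val x (g.raise e ν) w • e ν = w := by
  have repr_eq : ∀ ν, g.val x (g.raise e ν) w = e.repr w ν := fun ν => by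
    conv_lhs => rw [← e.sum_repr w]
    simp only [map_sum, map_smul, g.val_raise, smul_eq_mul, mul_ite, mul_one, mul_zero,
      Finset.sum_ite_eq', Finset.mem_univ, if_true]
  simp only [repr_eq, e.sum_repr]

theorem sum_smul_raise (w : TangentSpace I x) : ∑ ν, g.val x w (e ν) • g.raise e ν = w := by
  rw [← sub_eq_zero]
  apply g.nondegenerate x
  intro v
  have pairing_basis : ∀ μ, g.val x (∑ ν, g.val x w (e ν) • g.raise e ν - w) (e μ) = 0 :=
    fun μ => by
    simp only [map_sub, map_sum, map_smul, sub_apply, sum_apply, smul_apply, g.val_raise,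
      smul_eq_mul, mul_ite, mul_one, mul_zero, Finset.sum_ite_eq, Finset.mem_univ, if_true,
      sub_self]
  rw [← e.sum_repr v, map_sum]
  exact Finset.sum_eq_zero fun μ _ => by rw [map_smul, pairing_basis, smul_zero]

theorem gram_raise_mul_gram :
    (Matrix.of fun μ ν => g.val x (g.raise e ν) (g.raise e μ))
      * (Matrix.of fun μ ν => g.val x (e μ) (e ν)) = 1 := by
  ext μ ν
  have h := congrArg (fun w => g.val x w (e ν)) (g.sum_raise_smul e (g.raise e μ))
  simp only [map_sum, map_smul, sum_apply, smul_apply, smul_eq_mul, g.val_raise] at h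
  simp only [Matrix.mul_apply, Matrix.of_apply, h, Matrix.one_apply, eq_comm]

variable {Λ : Type*} [Ring Λ] [Algebra 𝕜 Λ] (p A : TangentSpace I x → Λ)

theorem contraction_eq (e' : Basis ι ℝ (TangentSpace I x))
    (hp : ∀ (r : ι → ℝ) (v : ι → TangentSpace I x),
      p (∑ i, r i • v i) = ∑ i, (r i : 𝕜) • p (v i))
    (hA : ∀ (r : ι → ℝ) (v : ι → TangentSpace I x),
      A (∑ i, r i • v i) = ∑ i, (r i : 𝕜) • A (v i)) :
    ∑ μ, p (g.raise e μ) * A (e μ) = ∑ μ, p (g.raise e' μ) * A (e' μ) :=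
  g.contraction_eq_of_dual (g.sum_smul_raise e) (g.sum_raise_smul e') p A hp hA

theorem contraction_flip
    (hp : ∀ (r : ι → ℝ) (v : ι → TangentSpace I x),
      p (∑ i, r i • v i) = ∑ i, (r i : 𝕜) • p (v i))
    (hA : ∀ (r : ι → ℝ) (v : ι → TangentSpace I x),
      A (∑ i, r i • v i) = ∑ i, (r i : 𝕜) • A (v i)) :
    ∑ μ, p (g.raise e μ) * A (e μ) = ∑ μ, p (e μ) * A (g.raise e μ) :=
  g.contraction_eq_of_dual (g.sum_smul_raise e)
    (fun w => by simpa only [g.symm x w] using g.sum_smul_raise e w) p A hp hA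

end PseudoRiemannianMetric

variable (g : PseudoRiemannianMetric I M) {x : M}

theorem contMDiffAt_metric {X Y : Π y : M, TangentSpace I y}
    (hX : ContMDiffAt I (I.prod 𝓘(ℝ, E)) ∞ (fun y ↦ TotalSpace.mk' E y (X y)) x)
    (hY : ContMDiffAt I (I.prod 𝓘(ℝ, E)) ∞ (fun y ↦ TotalSpace.mk' E y (Y y)) x) :
    ContMDiffAt I 𝓘(ℝ, ℝ) ∞ (fun y => g.val y (X y) (Y y)) x := by
  have h : ContMDiffAt I (I.prod 𝓘(ℝ, ℝ)) ∞
      (fun y ↦ TotalSpace.mk' ℝ (E := Bundle.Trivial M ℝ) y (g.val y (X y) (Y y))) x :=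
    ContMDiffAt.clm_bundle_apply₂ (F₁ := E) (F₂ := E) (g.contMDiff x) hX hY
  simpa using (contMDiffAt_totalSpace.1 h).2

variable [DecidableEq ι]

theorem contMDiffAt_raise (b : ∀ y : M, Basis ι ℝ (TangentSpace I y))
    (hb : ∀ μ, ContMDiffAt I (I.prod 𝓘(ℝ, E)) ∞ (fun y ↦ TotalSpace.mk' E y (b y μ)) x) (μ : ι) :
    ContMDiffAt I (I.prod 𝓘(ℝ, E)) ∞ (fun y ↦ TotalSpace.mk' E y (g.raise (b y) μ)) x := by
  let gram : M → Matrix ι ι ℝ := fun y => Matrix.of fun μ ν => g.val y (b y μ) (b y ν)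
  have gram_inv : ∀ y μ ν, g.val y (g.raise (b y) ν) (g.raise (b y) μ) = (gram y)⁻¹ μ ν :=
    fun y μ ν => congrFun₂ (Matrix.inv_eq_left_inv (g.gram_raise_mul_gram (b y))).symm μ ν
  have hraise : ∀ y, g.raise (b y) μ = ∑ ν, (gram y)⁻¹ μ ν • b y ν := fun y => by
    simp only [← gram_inv, g.sum_raise_smul]
  have det_ne_zero : (gram x).det ≠ 0 :=
    (Matrix.isUnit_det_of_left_inverse (g.gram_raise_mul_gram (b x))).ne_zero
  simp only [hraise]
  exact ContMDiffAt.sum_section fun ν _ => (contMDiffAt_matrix_inv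
    (fun i j => contMDiffAt_metric g (hb i) (hb j)) det_ne_zero μ ν).smul_section (hb ν)

theorem IsLeviCivita.nabla_raise {g}
    {nabla : CovariantDerivative I E (TangentSpace I : M → Type _)} (hnabla : IsLeviCivita g nabla)
    (b : ∀ y : M, Basis ι ℝ (TangentSpace I y))
    (hb : ∀ μ, ContMDiffAt I (I.prod 𝓘(ℝ, E)) ∞ (fun y ↦ TotalSpace.mk' E y (b y μ)) x) (μ : ι)
    (v : TangentSpace I x) :
    nabla (fun y => g.raise (b y) μ) x v
      = -∑ l, g.val x (g.raise (b x) μ) (nabla (fun y => b y l) x v) • g.raise (b x) l := by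
  conv_lhs => rw [← g.sum_smul_raise (b x) (nabla (fun y => g.raise (b y) μ) x v)]
  rw [← Finset.sum_neg_distrib]
  refine Finset.sum_congr rfl fun l _ => ?_
  -- Differentiate the constant `g(e^μ, e_l)`.
  have h := hnabla.metric x v (fun y => g.raise (b y) μ) (fun y => b y l)
    ((contMDiffAt_raise g b hb μ).mdifferentiableAt (by simp)) ((hb l).mdifferentiableAt (by simp))
  simp only [g.val_raise] at h
  rw [mvfderiv_const, zero_apply] at h
  rw [← neg_smul, eq_neg_of_add_eq_zero_left h.symm]

end Frames

section Tensoriality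

variable {𝕜 : Type*} [RCLike 𝕜]
  {E : Type*} [NormedAddCommGroup E] [NormedSpace ℝ E]
  {H : Type*} [TopologicalSpace H] {I : ModelWithCorners ℝ E H}
  {M : Type*} [TopologicalSpace M] [ChartedSpace H M] [IsManifold I ∞ M]
  {F : Type*} [NormedAddCommGroup F] [NormedSpace ℝ F]
  {S : M → Type*} [TopologicalSpace (TotalSpace F S)]
  [∀ x, AddCommGroup (S x)] [∀ x, Module ℝ (S x)] [∀ x, Module 𝕜 (S x)]
  [∀ x, TopologicalSpace (S x)] [∀ x, IsTopologicalAddGroup (S x)]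
  [∀ x, ContinuousSMul ℝ (S x)]
  [FiberBundle F S] [VectorBundle ℝ F S]
  {g : PseudoRiemannianMetric I M} (γ : CliffordMultiplication 𝕜 F S g)

section Smooth

variable {x : M} {Y : Π y : M, TangentSpace I y} {ξ : Π y : M, S y}

theorem mdifferentiableAt_clifford_section
    (hY : MDifferentiableAt I (I.prod 𝓘(ℝ, E)) (fun y ↦ TotalSpace.mk' E y (Y y)) x)
    (hξ : MDifferentiableAt I (I.prod 𝓘(ℝ, F)) (fun y ↦ TotalSpace.mk' F y (ξ y)) x) :
    MDifferentiableAt I (I.prod 𝓘(ℝ, F)) (fun y ↦ TotalSpace.mk' F y (γ.val y (Y y) (ξ y))) x :=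
  MDifferentiableAt.clm_bundle_apply₂ (F₁ := E) (F₂ := F)
    ((γ.contMDiff x).mdifferentiableAt (by simp)) hY hξ

theorem contMDiffAt_clifford_section
    (hY : ContMDiffAt I (I.prod 𝓘(ℝ, E)) ∞ (fun y ↦ TotalSpace.mk' E y (Y y)) x)
    (hξ : ContMDiffAt I (I.prod 𝓘(ℝ, F)) ∞ (fun y ↦ TotalSpace.mk' F y (ξ y)) x) :
    ContMDiffAt I (I.prod 𝓘(ℝ, F)) ∞ (fun y ↦ TotalSpace.mk' F y (γ.val y (Y y) (ξ y))) x :=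
  ContMDiffAt.clm_bundle_apply₂ (F₁ := E) (F₂ := F) (γ.contMDiff x) hY hξ

theorem contMDiffAt_clifford_raise [FiniteDimensional ℝ E] {ι : Type*} [Fintype ι] [DecidableEq ι]
    (e : ∀ x : M, Basis ι ℝ (TangentSpace I x)) (φ : ContMDiffSection I F ∞ S) (x : M) (ν : ι) :
    ContMDiffAt I (I.prod 𝓘(ℝ, F)) ∞ (fun y ↦ TotalSpace.mk' F y
      (γ.val y (g.raise (localFrame I e x y) ν) (φ y))) x :=
  contMDiffAt_clifford_section γ
    (contMDiffAt_raise g (localFrame I e x) (contMDiffAt_localFrame e x) ν) (φ.contMDiff x)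

end Smooth

variable (nabla : CovariantDerivative I E (TangentSpace I : M → Type _))
  (D DC : SpinorConnection 𝕜 I F S)

/-- The expression `(D̂_u γ)(Y)ξ` for vector fields `Y` and sections `ξ`; it is tensorial in both,
which makes `hatDgamma` independent of the extensions used to define it. -/
def hatDgammaField {x : M} (u : TangentSpace I x) (Y : Π y : M, TangentSpace I y)
    (ξ : Π y : M, S y) : S x :=
  D.toFun (fun y => γ.val y (Y y) (ξ y)) x u - γ.val x (nabla Y x u) (ξ x)
    - γ.val x (Y x) (DC.toFun ξ x u)

variable {x : M} (u : TangentSpace I x)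

theorem tensorialAt_hatDgammaField_left {ξ : Π y : M, S y}
    (hξ : MDifferentiableAt I (I.prod 𝓘(ℝ, F)) (fun y ↦ TotalSpace.mk' F y (ξ y)) x) :
    TensorialAt I E (fun Y => hatDgammaField γ nabla D DC u Y ξ) x where
  smul {f Y} hf hY := by
    have clifford_smul : (fun y => γ.val y ((f • Y) y) (ξ y))
        = f • fun y => γ.val y (Y y) (ξ y) := by
      funext y
      simp
    simp only [hatDgammaField]
    rw [clifford_smul, D.isCovariantDerivativeOnUniv.leibniz
        (mdifferentiableAt_clifford_section γ hY hξ) hf,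
      show nabla (f • Y) x = _ from nabla.isCovariantDerivativeOnUniv.leibniz hY hf]
    simp only [add_apply, smul_apply, ContinuousLinearMap.smulRight_apply, map_add,
      _root_.map_smul, Pi.smul_apply']
    module
  add {Y Y'} hY hY' := by
    have clifford_add : (fun y => γ.val y ((Y + Y') y) (ξ y))
        = (fun y => γ.val y (Y y) (ξ y)) + fun y => γ.val y (Y' y) (ξ y) := by
      funext y
      simp
    simp only [hatDgammaField]
    rw [clifford_add, D.isCovariantDerivativeOnUniv.add
        (mdifferentiableAt_clifford_section γ hY hξ) (mdifferentiableAt_clifford_section γ hY' hξ),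
      show nabla (Y + Y') x = _ from nabla.isCovariantDerivativeOnUniv.add hY hY']
    simp only [add_apply, map_add, Pi.add_apply]
    abel

theorem tensorialAt_hatDgammaField_right {Y : Π y : M, TangentSpace I y}
    (hY : MDifferentiableAt I (I.prod 𝓘(ℝ, E)) (fun y ↦ TotalSpace.mk' E y (Y y)) x) :
    TensorialAt I F (hatDgammaField γ nabla D DC u Y) x where
  smul {f ξ} hf hξ := by
    have clifford_smul : (fun y => γ.val y (Y y) ((f • ξ) y))
        = f • fun y => γ.val y (Y y) (ξ y) := by
      funext y
      simp
    simp only [hatDgammaField]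
    rw [clifford_smul, D.isCovariantDerivativeOnUniv.leibniz
        (mdifferentiableAt_clifford_section γ hY hξ) hf,
      DC.isCovariantDerivativeOnUniv.leibniz hξ hf]
    simp only [add_apply, smul_apply, ContinuousLinearMap.smulRight_apply, map_add,
      _root_.map_smul, Pi.smul_apply']
    module
  add {ξ ξ'} hξ hξ' := by
    have clifford_add : (fun y => γ.val y (Y y) ((ξ + ξ') y))
        = (fun y => γ.val y (Y y) (ξ y)) + fun y => γ.val y (Y y) (ξ' y) := by
      funext y
      simp
    simp only [hatDgammaField]
    rw [clifford_add, D.isCovariantDerivativeOnUniv.add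
        (mdifferentiableAt_clifford_section γ hY hξ) (mdifferentiableAt_clifford_section γ hY hξ'),
      DC.isCovariantDerivativeOnUniv.add hξ hξ']
    simp only [add_apply, map_add, Pi.add_apply]
    abel

variable [NormedSpace 𝕜 F] [VectorBundle 𝕜 F S] [IsScalarTower ℝ 𝕜 F]

theorem ι_clifford_sum_smul (s : S x) {α : Type*} [Fintype α]
    (r : α → ℝ) (v : α → TangentSpace I x) :
    ExteriorAlgebra.ι 𝕜 (γ.val x (∑ i, r i • v i) s)
      = ∑ i, (r i : 𝕜) • ExteriorAlgebra.ι 𝕜 (γ.val x (v i) s) := by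
  simp only [map_sum, _root_.map_smul, sum_apply, smul_apply,
    ← ofReal_smul_fibre (𝕜 := 𝕜) F x]

variable [ContMDiffVectorBundle ∞ F S I]

theorem hatDgamma_eq_half_torsion {K : Set (ContMDiffSection I F ∞ S)}
    (hadm : IsAdmissible γ nabla D DC K) {η : ContMDiffSection I F ∞ S} (hη : η ∈ K)
    (v : TangentSpace I x) :
    hatDgamma γ nabla D DC x u v (η x)
      = (1 / 2 : 𝕜) • torsion γ nabla D DC x u v (η x) := by
  have h := hadm η hη x u v
  rw [LinearMap.add_apply] at h
  rw [torsion, LinearMap.sub_apply, eq_neg_of_add_eq_zero_right h, sub_neg_eq_add, ← two_smul 𝕜,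
    smul_smul]
  norm_num

theorem hatDgamma_eq_hatDgammaField_localExt (v : TangentSpace I x) (s : S x) :
    hatDgamma γ nabla D DC x u v s
      = hatDgammaField γ nabla D DC u (localExt ℝ E v) (localExt 𝕜 F s) := by
  simp only [hatDgamma, hatDgammaField, LinearMap.coe_mk, AddHom.coe_mk, localExt_self]

theorem hatDgamma_add (v w : TangentSpace I x) (s : S x) :
    hatDgamma γ nabla D DC x u (v + w) s
      = hatDgamma γ nabla D DC x u v s + hatDgamma γ nabla D DC x u w s := by
  simp only [hatDgamma_eq_hatDgammaField_localExt, localExt_add]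
  exact (tensorialAt_hatDgammaField_left γ nabla D DC u (mdifferentiableAt_localExt 𝕜 F s)).add
    (mdifferentiableAt_localExt ℝ E v) (mdifferentiableAt_localExt ℝ E w)

theorem hatDgamma_smul (r : ℝ) (v : TangentSpace I x) (s : S x) :
    hatDgamma γ nabla D DC x u (r • v) s = r • hatDgamma γ nabla D DC x u v s := by
  simp only [hatDgamma_eq_hatDgammaField_localExt, localExt_smul]
  exact (tensorialAt_hatDgammaField_left γ nabla D DC u (mdifferentiableAt_localExt 𝕜 F s)).smul
    (f := fun _ => r) mdifferentiableAt_const (mdifferentiableAt_localExt ℝ E v)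

/-- The torsion as a linear map in its second argument, so that its contractions over dual frames
are frame independent. -/
def torsionLin (s : S x) : TangentSpace I x →ₗ[ℝ] S x where
  toFun v := torsion γ nabla D DC x u v s
  map_add' v w := by
    simp only [torsion, LinearMap.sub_apply, hatDgamma_add]
    simp only [hatDgamma, LinearMap.coe_mk, AddHom.coe_mk, map_add, add_apply]
    abel
  map_smul' r v := by
    simp only [torsion, LinearMap.sub_apply, hatDgamma_smul, RingHom.id_apply]
    simp only [hatDgamma, LinearMap.coe_mk, AddHom.coe_mk, _root_.map_smul, smul_apply, smul_sub]

theorem ι_torsion_sum_smul (s : S x) {α : Type*} [Fintype α]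
    (r : α → ℝ) (v : α → TangentSpace I x) :
    ExteriorAlgebra.ι 𝕜 (torsion γ nabla D DC x u (∑ i, r i • v i) s)
      = ∑ i, (r i : 𝕜) • ExteriorAlgebra.ι 𝕜 (torsion γ nabla D DC x u (v i) s) := by
  have h := map_sum (torsionLin γ nabla D DC u s) (fun i => r i • v i) Finset.univ
  simp only [_root_.map_smul, ← ofReal_smul_fibre (𝕜 := 𝕜) F x] at h
  refine (congrArg (ExteriorAlgebra.ι 𝕜) h).trans ?_
  simp only [map_sum, _root_.map_smul]
  rfl

variable [FiniteDimensional ℝ E] [FiniteDimensional 𝕜 F]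

theorem hatDgamma_apply {Y : Π y : M, TangentSpace I y} {ξ : Π y : M, S y}
    (hY : MDifferentiableAt I (I.prod 𝓘(ℝ, E)) (fun y ↦ TotalSpace.mk' E y (Y y)) x)
    (hξ : MDifferentiableAt I (I.prod 𝓘(ℝ, F)) (fun y ↦ TotalSpace.mk' F y (ξ y)) x) :
    hatDgamma γ nabla D DC x u (Y x) (ξ x) = hatDgammaField γ nabla D DC u Y ξ := by
  have : FiniteDimensional ℝ F := FiniteDimensional.trans ℝ 𝕜 F
  have : ContMDiffVectorBundle 1 F S I := ContMDiffVectorBundle.of_le (n := ∞) (by simp)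
  rw [hatDgamma_eq_hatDgammaField_localExt]
  exact TensorialAt.pointwise₂ (I := I) (F := E) (F' := F)
    (fun _ => tensorialAt_hatDgammaField_left γ nabla D DC u)
    (fun _ => tensorialAt_hatDgammaField_right γ nabla D DC u)
    (mdifferentiableAt_localExt ℝ E (Y x)) hY (mdifferentiableAt_localExt 𝕜 F (ξ x)) hξ
    (localExt_self ℝ E _) (localExt_self 𝕜 F _)

end Tensoriality

theorem superBracket_one_one {𝕜 : Type*} [RCLike 𝕜] {M : Type*} {S : M → Type*}
    [∀ x, AddCommGroup (S x)] [∀ x, Module 𝕜 (S x)]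
    (Z W : (Π x, ExteriorAlgebra 𝕜 (S x)) → (Π x, ExteriorAlgebra 𝕜 (S x)))
    (f : Π x, ExteriorAlgebra 𝕜 (S x)) :
    superBracket 1 1 Z W f = Z (W f) + W (Z f) := by
  rw [superBracket, ZMod.val_one, mul_one, pow_one, neg_one_smul, sub_neg_eq_add]

section SuperVectorField

variable {𝕜 : Type*} [RCLike 𝕜]
  {E : Type*} [NormedAddCommGroup E] [NormedSpace ℝ E]
  {H : Type*} [TopologicalSpace H] {I : ModelWithCorners ℝ E H}
  {M : Type*} [TopologicalSpace M] [ChartedSpace H M] [IsManifold I ∞ M]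
  {F : Type*} [NormedAddCommGroup F] [NormedSpace ℝ F] [NormedSpace 𝕜 F]
  [IsScalarTower ℝ 𝕜 F] [FiniteDimensional 𝕜 F]
  {S : M → Type*} [TopologicalSpace (TotalSpace F S)]
  [∀ x, AddCommGroup (S x)] [∀ x, Module ℝ (S x)] [∀ x, Module 𝕜 (S x)]
  [∀ x, TopologicalSpace (S x)] [∀ x, IsTopologicalAddGroup (S x)]
  [∀ x, ContinuousSMul ℝ (S x)]
  [FiberBundle F S] [VectorBundle ℝ F S] [VectorBundle 𝕜 F S] [ContMDiffVectorBundle ∞ F S I]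
  {g : PseudoRiemannianMetric I M} (γ : CliffordMultiplication 𝕜 F S g)
  {nabla : CovariantDerivative I E (TangentSpace I : M → Type _)}
  (D DC : SpinorConnection 𝕜 I F S)
  {ι : Type*} [Fintype ι] [DecidableEq ι] (e : ∀ x : M, Basis ι ℝ (TangentSpace I x))
  {f h : Π x, ExteriorAlgebra 𝕜 (S x)} {x : M}

-- `e` need not be continuous; `localFrame I e x` is smooth near `x`.
theorem iota_eventuallyEq_localFrame (φ : Π x, S x) (f : Π x, ExteriorAlgebra 𝕜 (S x)) (x : M) :
    ∀ᶠ y in 𝓝 x, iota γ D e φ f y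
      = ∑ ν, ExteriorAlgebra.ι 𝕜 (γ.val y (g.raise (localFrame I e x y) ν) (φ y))
          * superD D f y (localExt ℝ E (e x ν) y) := by
  filter_upwards [(trivializationAt E (TangentSpace I : M → Type _) x).open_baseSet.mem_nhds
    (FiberBundle.mem_baseSet_trivializationAt' x)] with y hy
  simp only [← localFrame_apply e hy]
  exact g.contraction_eq (e y) (fun v => ExteriorAlgebra.ι 𝕜 (γ.val y v (φ y))) (superD D f y)
    (localFrame I e x y) (ι_clifford_sum_smul γ (φ y)) (superD_sum_vec D f y Finset.univ)

variable [FiniteDimensional ℝ E]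

theorem smoothSuperAt_superD_localExt (hf : IsSuperfunction I F f) (v : TangentSpace I x) :
    SmoothSuperAt I F (fun y => superD D f y (localExt ℝ E v y)) x :=
  smoothSuperAt_superD D (trivializationAt E (TangentSpace I : M → Type _) x).open_baseSet
    (fun y _ => isSuperfunction_iff.1 hf y) (contMDiffOn_localExt x v)
    (FiberBundle.mem_baseSet_trivializationAt' x)

theorem isSuperfunction_iota (φ : ContMDiffSection I F ∞ S) (hf : IsSuperfunction I F f) :
    IsSuperfunction I F (iota γ D e φ f) :=
  isSuperfunction_iff.2 fun x =>
    (SmoothSuperAt.sum fun ν _ =>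
      (SmoothSuperAt.of_section (contMDiffAt_clifford_raise γ e φ x ν)).mul
        (smoothSuperAt_superD_localExt D hf (e x ν))).congr
      (iota_eventuallyEq_localFrame γ D e φ f x)

theorem isSuperVectorField_iota (φ : ContMDiffSection I F ∞ S) :
    IsSuperVectorField I F 1 (iota γ D e φ) where
  smooth f hf := isSuperfunction_iota γ D e φ hf
  map_add f h hf hh := by
    rw [isSuperfunction_iff] at hf hh
    funext x
    simp only [iota, Pi.add_apply, superD_add D (hf x) (hh x), mul_add, Finset.sum_add_distrib]
  map_smul c f hf := by
    rw [isSuperfunction_iff] at hf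
    funext x
    simp only [iota, Pi.smul_apply, superD_const_smul D c (hf x), mul_smul_comm, Finset.smul_sum]
  parity q f hf hq x := Submodule.sum_mem _ fun μ _ =>
    SetLike.mul_mem_graded (CliffordAlgebra.ι_mem_evenOdd_one _ _)
      (superD_mem_evenOdd D (isSuperfunction_iff.1 hf x) hq _)
  leibniz q f h hf hq hh := by
    rw [isSuperfunction_iff] at hf hh
    funext x
    simp only [iota, Pi.add_apply, Pi.mul_apply, Pi.smul_apply, superD_mul D (hf x) (hh x),
      Finset.sum_mul, Finset.mul_sum, Finset.smul_sum, mul_add, Finset.sum_add_distrib]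
    congr 1
    · simp only [mul_assoc]
    · refine Finset.sum_congr rfl fun μ _ => ?_
      rw [← mul_assoc, ι_mul_of_mem_evenOdd _ (hq x), smul_mul_assoc, mul_assoc, ZMod.val_one,
        one_mul]

/-- The second covariant derivative of a superfunction. Its antisymmetric part is the curvature,
because the Levi-Civita connection is torsion-free. -/
def hessian (nabla : CovariantDerivative I E (TangentSpace I : M → Type _))
    (D : SpinorConnection 𝕜 I F S) (f : Π x, ExteriorAlgebra 𝕜 (S x)) (x : M)
    (u v : TangentSpace I x) : ExteriorAlgebra 𝕜 (S x) :=
  superD D (fun y => superD D f y (localExt ℝ E v y)) x u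
    - superD D f x (nabla (localExt ℝ E v) x u)

theorem hessian_sub_hessian (hnabla : IsLeviCivita g nabla) (hf : IsSuperfunction I F f)
    (u v : TangentSpace I x) :
    hessian nabla D f x u v - hessian nabla D f x v u = derivOfEnd (curvature D x u v) (f x) := by
  have commutator := superD_commutator D
    (trivializationAt E (TangentSpace I : M → Type _) x).open_baseSet
    (fun y _ => isSuperfunction_iff.1 hf y) (FiberBundle.mem_baseSet_trivializationAt' x) u v
    (contMDiffOn_localExt x u) (contMDiffOn_localExt x v)
  have torsion_free := hnabla.torsion_free x _ _ (mdifferentiableAt_localExt ℝ E u)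
    (mdifferentiableAt_localExt ℝ E v)
  rw [localExt_self, localExt_self, sub_eq_iff_eq_add] at torsion_free
  rw [hessian, hessian, torsion_free, superD_add_vec, sub_sub_sub_comm, commutator]
  abel

theorem covariantDerivative_clifford_raise (hnabla : IsLeviCivita g nabla)
    {η : ContMDiffSection I F ∞ S} (u : TangentSpace I x) (hη : DC.toFun η x u = 0) (ν : ι) :
    D.toFun (fun y => γ.val y (g.raise (localFrame I e x y) ν) (η y)) x u
      = hatDgamma γ nabla D DC x u (g.raise (e x) ν) (η x)
        - ∑ l, (g.val x (g.raise (e x) ν) (nabla (localExt ℝ E (e x l)) x u) : 𝕜)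
          • γ.val x (g.raise (e x) l) (η x) := by
  have hatD := hatDgamma_apply γ nabla D DC u
    ((contMDiffAt_raise g (localFrame I e x) (contMDiffAt_localFrame e x) ν).mdifferentiableAt
      (by simp)) ((η.contMDiff x).mdifferentiableAt (by simp))
  rw [hatDgammaField, hη,
    hnabla.nabla_raise (localFrame I e x) (contMDiffAt_localFrame e x)] at hatD
  simp only [nabla_localFrame, localFrame_self, map_zero, sub_zero, map_neg, neg_apply,
    sub_neg_eq_add] at hatD
  rw [hatD]
  simp only [map_sum, _root_.map_smul, sum_apply, smul_apply, ofReal_smul_fibre (𝕜 := 𝕜) F x,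
    add_sub_cancel_right]

theorem superD_clifford_raise_mul (hnabla : IsLeviCivita g nabla) (hf : IsSuperfunction I F f)
    {η : ContMDiffSection I F ∞ S} (u : TangentSpace I x) (hη : DC.toFun η x u = 0) (ν : ι) :
    superD D (fun y => ExteriorAlgebra.ι 𝕜 (γ.val y (g.raise (localFrame I e x y) ν) (η y))
        * superD D f y (localExt ℝ E (e x ν) y)) x u
      = ExteriorAlgebra.ι 𝕜 (hatDgamma γ nabla D DC x u (g.raise (e x) ν) (η x))
          * superD D f x (e x ν)
        - ∑ l, (g.val x (g.raise (e x) ν) (nabla (localExt ℝ E (e x l)) x u) : 𝕜)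
          • (ExteriorAlgebra.ι 𝕜 (γ.val x (g.raise (e x) l) (η x)) * superD D f x (e x ν))
        + ExteriorAlgebra.ι 𝕜 (γ.val x (g.raise (e x) ν) (η x))
          * superD D (fun y => superD D f y (localExt ℝ E (e x ν) y)) x u := by
  have smooth_raise := contMDiffAt_clifford_raise γ e η x ν
  refine (superD_mul D (SmoothSuperAt.of_section smooth_raise)
    (smoothSuperAt_superD_localExt D hf (e x ν)) u).trans ?_
  rw [superD_ι D smooth_raise, covariantDerivative_clifford_raise γ D DC e hnabla u hη]
  simp only [localExt_self, localFrame_self, map_sub, sub_mul, map_sum, _root_.map_smul,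
    Finset.sum_mul, smul_mul_assoc]

theorem superD_iota (hnabla : IsLeviCivita g nabla) (hf : IsSuperfunction I F f)
    {η : ContMDiffSection I F ∞ S} (u : TangentSpace I x) (hη : DC.toFun η x u = 0) :
    superD D (iota γ D e η f) x u
      = ∑ ν, (ExteriorAlgebra.ι 𝕜 (hatDgamma γ nabla D DC x u (g.raise (e x) ν) (η x))
            * superD D f x (e x ν)
          + ExteriorAlgebra.ι 𝕜 (γ.val x (g.raise (e x) ν) (η x))
            * hessian nabla D f x u (e x ν)) := by
  have leibniz_sum := superD_sum D Finset.univ (fun ν _ =>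
    (SmoothSuperAt.of_section (𝕜 := 𝕜) (contMDiffAt_clifford_raise γ e η x ν)).mul
      (smoothSuperAt_superD_localExt D hf (e x ν))) u
  simp only [Pi.mul_def] at leibniz_sum
  have expand_nabla : ∀ l, superD D f x (nabla (localExt ℝ E (e x l)) x u)
      = ∑ ν, (g.val x (g.raise (e x) ν) (nabla (localExt ℝ E (e x l)) x u) : 𝕜)
        • superD D f x (e x ν) := fun l => by
    rw [← superD_sum_vec, g.sum_raise_smul]
  -- The two sums of Christoffel symbols, from `∇e^ν` and from the Hessian, agree.
  have christoffel := Finset.sum_comm (s := Finset.univ) (t := Finset.univ) (f := fun ν l =>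
    (g.val x (g.raise (e x) ν) (nabla (localExt ℝ E (e x l)) x u) : 𝕜)
      • (ExteriorAlgebra.ι 𝕜 (γ.val x (g.raise (e x) l) (η x)) * superD D f x (e x ν)))
  rw [superD_congr D (iota_eventuallyEq_localFrame γ D e η f x), leibniz_sum]
  simp only [superD_clifford_raise_mul γ D DC e hnabla hf u hη, hessian, expand_nabla, mul_sub,
    Finset.mul_sum, mul_smul_comm, Finset.sum_add_distrib, Finset.sum_sub_distrib, christoffel]
  abel

theorem iota_iota {K : Set (ContMDiffSection I F ∞ S)} (hnabla : IsLeviCivita g nabla)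
    (hadm : IsAdmissible γ nabla D DC K) (hf : IsSuperfunction I F f)
    (φ : Π x, S x) {ψ : ContMDiffSection I F ∞ S} (hψ : ψ ∈ K)
    (hpar : ∀ v : TangentSpace I x, DC.toFun ψ x v = 0) :
    iota γ D e φ (iota γ D e ψ f) x
      = (1 / 2 : 𝕜) • ∑ μ, ∑ ν, ExteriorAlgebra.ι 𝕜 (γ.val x (g.raise (e x) μ) (φ x))
          * ExteriorAlgebra.ι 𝕜 (torsion γ nabla D DC x (e x μ) (e x ν) (ψ x))
          * superD D f x (g.raise (e x) ν)
        + ∑ μ, ∑ ν, ExteriorAlgebra.ι 𝕜 (γ.val x (g.raise (e x) μ) (φ x))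
          * ExteriorAlgebra.ι 𝕜 (γ.val x (g.raise (e x) ν) (ψ x))
          * hessian nabla D f x (e x μ) (e x ν) := by
  rw [iota, Finset.smul_sum, ← Finset.sum_add_distrib]
  refine Finset.sum_congr rfl fun μ _ => ?_
  have flip := g.contraction_flip (e x)
    (fun v => ExteriorAlgebra.ι 𝕜 (torsion γ nabla D DC x (e x μ) v (ψ x))) (superD D f x)
    (ι_torsion_sum_smul γ nabla D DC (e x μ) (ψ x)) (superD_sum_vec D f x Finset.univ)
  rw [superD_iota γ D DC e hnabla hf _ (hpar _), Finset.sum_add_distrib, mul_add]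
  simp only [hatDgamma_eq_half_torsion γ nabla D DC (e x μ) hadm hψ, _root_.map_smul,
    smul_mul_assoc, ← Finset.smul_sum, flip, mul_smul_comm, Finset.mul_sum, mul_assoc]

end SuperVectorField

end SpinorSuper

end

theorem proposition4p14_general {𝕜 : Type*} [RCLike 𝕜]
    {E : Type*} [NormedAddCommGroup E] [NormedSpace ℝ E] [FiniteDimensional ℝ E]
    {H : Type*} [TopologicalSpace H] {I : ModelWithCorners ℝ E H}
    {M : Type*} [TopologicalSpace M] [ChartedSpace H M] [IsManifold I ∞ M]
    {F : Type*} [NormedAddCommGroup F] [NormedSpace ℝ F] [NormedSpace 𝕜 F] [IsScalarTower ℝ 𝕜 F]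
    [FiniteDimensional 𝕜 F]
    {S : M → Type*} [TopologicalSpace (TotalSpace F S)]
    [∀ x, AddCommGroup (S x)] [∀ x, Module ℝ (S x)] [∀ x, Module 𝕜 (S x)]
    [∀ x, TopologicalSpace (S x)] [∀ x, IsTopologicalAddGroup (S x)]
    [∀ x, ContinuousSMul ℝ (S x)]
    [FiberBundle F S] [VectorBundle ℝ F S] [VectorBundle 𝕜 F S] [ContMDiffVectorBundle ∞ F S I]
    (g : PseudoRiemannianMetric I M)
    (nabla : CovariantDerivative I E (TangentSpace I : M → Type _)) (hnabla : IsLeviCivita g nabla)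
    (γ : CliffordMultiplication 𝕜 F S g) (C : ChargeConjugation 𝕜 γ)
    (D DC : SpinorConnection 𝕜 I F S) (_hDC : IsChargeAdjoint C D DC)
    (K : Set (ContMDiffSection I F ∞ S))
    (hpar : ∀ φ ∈ K, ∀ (x : M) (v : TangentSpace I x), DC.toFun φ x v = 0)
    (hadm : IsAdmissible γ nabla D DC K)
    {ι : Type*} [Fintype ι] [DecidableEq ι] (e : ∀ x : M, Basis ι ℝ (TangentSpace I x)) :
    (∀ φ : ContMDiffSection I F ∞ S, IsSuperVectorField I F 1 (iota γ D e φ)) ∧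
    ∀ φ ∈ K, ∀ ψ ∈ K, ∀ f : (Π x, ExteriorAlgebra 𝕜 (S x)), IsSuperfunction I F f →
      superBracket 1 1 (iota γ D e φ) (iota γ D e ψ) f
        = curvatureTerm γ (curvature D) e φ ψ f
          + (1 / 2 : 𝕜) • torsionTerm γ D (torsion γ nabla D DC) e φ ψ f := by
  refine ⟨isSuperVectorField_iota γ D e, fun φ hφ ψ hψ f hf => ?_⟩
  funext x
  have antisymm := sum_ι_mul_ι_mul_add_swap (R := 𝕜)
    (fun μ => γ.val x (g.raise (e x) μ) (φ x)) (fun μ => γ.val x (g.raise (e x) μ) (ψ x))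
    (fun μ ν => hessian nabla D f x (e x μ) (e x ν))
  simp only [hessian_sub_hessian D hnabla hf] at antisymm
  rw [superBracket_one_one, Pi.add_apply, iota_iota γ D DC e hnabla hadm hf φ hψ (hpar ψ hψ x),
    iota_iota γ D DC e hnabla hadm hf ψ hφ (hpar φ hφ x), Pi.add_apply, curvatureTerm,
    ← antisymm]
  simp only [torsionTerm, Pi.smul_apply, add_mul, Finset.sum_add_distrib, smul_add]
  abel

theorem proposition4p14 {𝕜 : Type*} [RCLike 𝕜]
    -- the manifold `M`
    {E : Type*} [NormedAddCommGroup E] [NormedSpace ℝ E] [FiniteDimensional ℝ E]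
    {H : Type*} [TopologicalSpace H] {I : ModelWithCorners ℝ E H}
    {M : Type*} [TopologicalSpace M] [ChartedSpace H M] [IsManifold I ∞ M]
    [BoundarylessManifold I M]
    -- the real (`𝕜 = ℝ`) or complex (`𝕜 = ℂ`) smooth vector bundle `S`
    {F : Type*} [NormedAddCommGroup F] [NormedSpace ℝ F] [NormedSpace 𝕜 F] [IsScalarTower ℝ 𝕜 F]
    [FiniteDimensional 𝕜 F]
    {S : M → Type*} [TopologicalSpace (TotalSpace F S)]
    [∀ x, AddCommGroup (S x)] [∀ x, Module ℝ (S x)] [∀ x, Module 𝕜 (S x)]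
    [∀ x, TopologicalSpace (S x)] [∀ x, IsTopologicalAddGroup (S x)]
    [∀ x, ContinuousSMul ℝ (S x)]
    [FiberBundle F S] [VectorBundle ℝ F S] [VectorBundle 𝕜 F S] [ContMDiffVectorBundle ∞ F S I]
    -- metric, Levi-Civita connection, Clifford multiplication, charge conjugation
    (g : PseudoRiemannianMetric I M)
    (nabla : CovariantDerivative I E (TangentSpace I : M → Type _)) (hnabla : IsLeviCivita g nabla)
    (γ : CliffordMultiplication 𝕜 F S g) (C : ChargeConjugation 𝕜 γ)
    -- the connection `D` and its associated connection `D^C`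
    (D DC : SpinorConnection 𝕜 I F S) (hDC : IsChargeAdjoint C D DC)
    -- an admissible linear space of `D^C`-parallel spinors
    (K : Submodule ℝ (ContMDiffSection I F ∞ S))
    (hpar : ∀ φ ∈ K, ∀ (x : M) (v : TangentSpace I x), DC.toFun φ x v = 0)
    (hadm : IsAdmissible γ nabla D DC (K : Set (ContMDiffSection I F ∞ S)))
    -- a basis of each tangent space, for instance the values of a local frame
    {ι : Type*} [Fintype ι] [DecidableEq ι] (e : ∀ x : M, Basis ι ℝ (TangentSpace I x)) :
    (∀ φ ∈ K, IsSuperVectorField I F 1 (iota γ D e φ)) ∧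
    ∀ φ ∈ K, ∀ ψ ∈ K, ∀ f : (Π x, ExteriorAlgebra 𝕜 (S x)), IsSuperfunction I F f →
      superBracket 1 1 (iota γ D e φ) (iota γ D e ψ) f
        = curvatureTerm γ (curvature D) e φ ψ f
          + (1 / 2 : 𝕜) • torsionTerm γ D (torsion γ nabla D DC) e φ ψ f :=
  let ⟨hfield, hbracket⟩ :=
    proposition4p14_general g nabla hnabla γ C D DC hDC K hpar hadm e
  ⟨fun φ _ => hfield φ, hbracket⟩
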